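/- Let $\beta_c=\sqrt{2\log 2}$ and $\beta>\beta_c$. For every $N$ let $(J_\alpha)_{\alpha\subseteq\{1,\dots,N\}}$ (a family that may depend on $N$) be i.i.d. standard Gaussian, all on one probability space, and consider the random energy model on $\{-1,+1\}^N$ with Hamiltonian $$H(\sigma)=-\frac{N^{1/2}}{2^{N/2}}\sum_{\alpha\subseteq\{1,\dots,N\}}J_\alpha\prod_{i\in\alpha}\sigma_i=\sqrt N\,X_\sigma ,$$ and Gibbs measure $\mu_{N,\beta}(\sigma)=e^{-\beta H(\sigma)}/\sum_{\sigma'}e^{-\beta H(\sigma')}$. Put $n=2^N$, let $X_{1,n}\le\dots\le X_{n,n}$ be the ordered values of $(X_\sigma)$ and let $(\tilde\sigma)_j$ be the configuration with $X_{(\tilde\sigma)_j}=X_{j,n}$. Let $d_{\mathrm{TV}}(\mu,\nu)=\sup_{\|\Psi\|_\infty=1}|\mu(\Psi)-\nu(\Psi)|$. For $k\ge1$ let $\mu^{(1)}_{k,\beta}$ be the probability measure on $\{(\tilde\sigma)_1,\dots,(\tilde\sigma)_{\min(k,n)}\}$ with weights proportional to $\exp\{-\frac{\beta}{\beta_c}\sqrt{2\log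 2^N}\,(X_{j,n}-X_{1,n})\}$. Let $U_{j,n}=\Phi(X_{j,n})$ for $1\le j\le n$ ($\Phi$ the standard Gaussian distribution function), $U_{n+1,n}=1$, and $$W^{(N)}_\ell=-\log\Big(\frac{U_{\ell,n}}{U_{\ell+1,n}}\Big)^{\ell},\qquad 1\le\ell\le n,$$ and for a sequence $w=(w_\ell)$ let $\zeta(\beta)=\zeta(\beta;w)=\sum_{j\ge2}\exp\big(-\frac{\beta}{\beta_c}\sum_{\ell=1}^{j}\frac{w_\ell}{\ell}\big)$ and let $\zeta_n(\beta;w)$ be the same sum restricted to $2\le j\le n$. (a) Whatever the joint law of the samples for different $N$: with probability $1$, for every fixed $k_0\ge1$, $d_{\mathrm{TV}}(\mu_{N,\beta},\mu^{(1)}_{k_0,\beta})$ does not tend to $0$ as $N\to\infty$, and for every $\varepsilon>0$, for all sufficiently large $N$, $$d_{\mathrm{TV}}(\mu_{N,\beta},\mu^{(1)}_{k_0,\beta})\ \ge\ \frac{\exp\big(-\frac{\beta}{\beta_c}\sum_{\ell=1}^{k_0}W^{(N)}_\ell/\ell\big)}{1+\zeta_{n}(\beta;W^{(N)})}-\varepsilon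 .$$ (b) Suppose that the samples of all sizes are realised from one sequence $(W_\ell)_{\ell\ge1}$ of i.i.d. exponential variables of mean $1$, that is, almost surely $W^{(N)}_\ell=W_\ell$ for all $N\geq 0$ and $1\le\ell\le 2^N$. For $k\ge1$ let $\mu^{(2)}_{k,\beta}$ be the probability measure on $\{(\tilde\sigma)_1,\dots,(\tilde\sigma)_{\min(k,n)}\}$ with weights proportional to $\exp(-\frac{\beta}{\beta_c}\sum_{\ell=1}^{j-1}W_\ell/\ell)$, $1\le j\le \min(k,n)$. Then with probability $1$: $\zeta(\beta)=\zeta(\beta;W)<\infty$ and, for every fixed $k_0\ge1$, each of the three quantities $$\liminf_{N\to\infty}d_{\mathrm{TV}}(\mu_{N,\beta},\mu^{(1)}_{k_0,\beta}),\qquad \liminf_{N\to\infty}d_{\mathrm{TV}}(\mu_{N,\beta},\mu^{(2)}_{k_0,\beta}),\qquad \liminf_{N\to\infty}d_{\mathrm{TV}}(\mu^{(2)}_{k_0,\beta},\mu^{(2)}_{k_N,\beta})$$ (the last one for every sequence of integers $k_N\to\infty$) is at least $$\frac{\exp\big(-\frac{\beta}{\beta_c}\sum_{\ell=1}^{k_0}W_\ell/\ell\big)}{1+\zeta(\beta)}>0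 .$$ (c) A realisation as in (b) exists: there is a probability space carrying i.i.d. mean-one exponential variables $(W_\ell)_{\ell\ge1}$ and, for every $N$, i.i.d. standard Gaussian $(J_\alpha)_{\alpha\subseteq\{1,\dots,N\}}$ such that almost surely $W^{(N)}_\ell=W_\ell$ for all $N\geq 0$ and $1\le\ell\le2^N$. -/

import Mathlib

open MeasureTheory ProbabilityTheory Filter Topology

noncomputable section

namespace REM

/-- Spin configurations `{-1, +1}^N`. -/
abbrev SpinConfig (N : ℕ) : Type := Fin N → ℤˣ

/-- The critical inverse temperature `β_c = √(2 log 2)`. -/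
def betaC : ℝ := Real.sqrt (2 * Real.log 2)

/-- `σ_α = ∏_{i ∈ α} σ_i`, with `σ_∅ = 1`. -/
def spinProd {N : ℕ} (σ : SpinConfig N) (α : Finset (Fin N)) : ℝ :=
  ∏ i ∈ α, ((σ i : ℤ) : ℝ)

/-- The Hamiltonian of the random energy model,
`H(σ) = -(N^{1/2} / 2^{N/2}) ∑_{α ⊆ {1,…,N}} J_α σ_α`. -/
def hamiltonian {N : ℕ} (J : Finset (Fin N) → ℝ) (σ : SpinConfig N) : ℝ :=
  -(Real.sqrt N / (2 : ℝ) ^ ((N : ℝ) / 2)) * ∑ α : Finset (Fin N), J α * spinProd σ α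

/-- The normalised energy `X_σ`, so that `H(σ) = √N X_σ`. -/
def energy {N : ℕ} (J : Finset (Fin N) → ℝ) (σ : SpinConfig N) : ℝ :=
  -(1 / (2 : ℝ) ^ ((N : ℝ) / 2)) * ∑ α : Finset (Fin N), J α * spinProd σ α

theorem hamiltonian_eq {N : ℕ} (J : Finset (Fin N) → ℝ) (σ : SpinConfig N) :
    hamiltonian J σ = Real.sqrt N * energy J σ := by
  unfold hamiltonian energy
  ring

/-- The partition function `Z_N(β)`. -/
def partitionFunction {N : ℕ} (β : ℝ) (J : Finset (Fin N) → ℝ) : ℝ :=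
  ∑ σ : SpinConfig N, Real.exp (-β * hamiltonian J σ)

/-- The mass function of the Gibbs measure `μ_{N,β}`. -/
def gibbs {N : ℕ} (β : ℝ) (J : Finset (Fin N) → ℝ) (σ : SpinConfig N) : ℝ :=
  Real.exp (-β * hamiltonian J σ) / partitionFunction β J

/-- `d_TV(μ, ν) = sup { |μ(Ψ) - ν(Ψ)| : ‖Ψ‖_∞ = 1 }` for mass functions on `{-1, +1}^N`
(the norm of `Ψ` is the sup norm; the values range over `[0, 2]` for probability measures). -/
def tvDist {N : ℕ} (μ ν : SpinConfig N → ℝ) : ℝ :=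
  sSup {r : ℝ | ∃ Ψ : SpinConfig N → ℝ, ‖Ψ‖ = 1 ∧
    r = |∑ σ, Ψ σ * μ σ - ∑ σ, Ψ σ * ν σ|}

theorem card_spinConfig (N : ℕ) : Fintype.card (SpinConfig N) = 2 ^ N := by
  simp [SpinConfig]

/-- A fixed enumeration of the configurations (it only serves to break ties). -/
def enumeration (N : ℕ) : Fin (2 ^ N) ≃ SpinConfig N :=
  (Fintype.equivFinOfCardEq (card_spinConfig N)).symm

/-- The configurations sorted by increasing `x`: `ranked x k` is the configuration carrying the
`(k+1)`-st smallest value of `x`. -/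
def ranked {N : ℕ} (x : SpinConfig N → ℝ) : Fin (2 ^ N) ≃ SpinConfig N :=
  (Tuple.sort (x ∘ enumeration N)).trans (enumeration N)

theorem monotone_ranked {N : ℕ} (x : SpinConfig N → ℝ) : Monotone (x ∘ ranked x) :=
  Tuple.monotone_sort (x ∘ enumeration N)

/-- The rank `0` (index of the minimum). -/
def firstRank (N : ℕ) : Fin (2 ^ N) := ⟨0, by positivity⟩

/-- The probability measure on the `k` configurations of lowest energy with weights proportional
to `w` (a function of the rank, counted from `0`); `k` is cut at `2^N`. -/
def truncated {N : ℕ} (x : SpinConfig N → ℝ) (w : Fin (2 ^ N) → ℝ) (k : ℕ)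
    (σ : SpinConfig N) : ℝ :=
  if (((ranked x).symm σ : Fin (2 ^ N)) : ℕ) < k then
    w ((ranked x).symm σ) / ∑ i ∈ Finset.univ.filter (fun i : Fin (2 ^ N) => (i : ℕ) < k), w i
  else 0

/-- `μ^{(1)}_{k,β}`: the weight of the configuration of rank `i` is
`exp (-(β/β_c) √(2 log 2^N) (X_{i,2^N} - X_{1,2^N}))`. -/
def truncGibbs {N : ℕ} (β : ℝ) (J : Finset (Fin N) → ℝ) (k : ℕ) : SpinConfig N → ℝ :=
  truncated (energy J)
    (fun i => Real.exp (-(β / betaC) * Real.sqrt (2 * Real.log ((2 : ℝ) ^ N)) *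
      (energy J (ranked (energy J) i) - energy J (ranked (energy J) (firstRank N))))) k

/-- `∑_{ℓ=1}^j W_ℓ / ℓ`. -/
def weightedSum (W : ℕ → ℝ) (j : ℕ) : ℝ := ∑ l ∈ Finset.Icc 1 j, W l / (l : ℝ)

/-- `μ^{(2)}_{k,β}`: the configuration with the `j`-th lowest energy has weight
`exp (-(β/β_c) ∑_{ℓ=1}^{j-1} W_ℓ/ℓ)`; here `i = j - 1`. -/
def truncExp {N : ℕ} (β : ℝ) (J : Finset (Fin N) → ℝ) (W : ℕ → ℝ) (k : ℕ) :
    SpinConfig N → ℝ :=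
  truncated (energy J) (fun i => Real.exp (-(β / betaC) * weightedSum W (i : ℕ))) k

/-- The terms `exp (-(β/β_c) ∑_{ℓ=1}^j W_ℓ/ℓ)`. -/
def zetaTerm (β : ℝ) (W : ℕ → ℝ) (j : ℕ) : ℝ :=
  Real.exp (-(β / betaC) * weightedSum W j)

/-- `ζ(β) = ∑_{j ≥ 2} exp (-(β/β_c) ∑_{ℓ=1}^j W_ℓ/ℓ)`. -/
def zeta (β : ℝ) (W : ℕ → ℝ) : ℝ := ∑' j : ℕ, zetaTerm β W (j + 2)

/-- The partial sum `∑_{j=2}^n exp (-(β/β_c) ∑_{ℓ=1}^j W_ℓ/ℓ)`. -/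
def zetaPartial (β : ℝ) (W : ℕ → ℝ) (n : ℕ) : ℝ := ∑ j ∈ Finset.Icc 2 n, zetaTerm β W j

/-- The order statistics `U_{j,n}`, `n = 2^N`, `0 ≤ j ≤ n + 1`, of the uniform variables
`U_σ = Φ(X_σ)`, with the conventions `U_{0,n} = 0` and `U_{n+1,n} = 1`. -/
def orderedUnif {N : ℕ} (J : Finset (Fin N) → ℝ) (j : ℕ) : ℝ :=
  if j = 0 then 0
  else if h : j - 1 < 2 ^ N then
    cdf (gaussianReal 0 1) (energy J (ranked (energy J) ⟨j - 1, h⟩))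
  else 1

/-- The variables `-log ((U_{ℓ,n} / U_{ℓ+1,n})^ℓ)`, `1 ≤ ℓ ≤ n = 2^N`, of a sample. -/
def spacing {N : ℕ} (J : Finset (Fin N) → ℝ) (l : ℕ) : ℝ :=
  -Real.log ((orderedUnif J l / orderedUnif J (l + 1)) ^ l)

/-- For each `N` the couplings `(J_α)_{α ⊆ {1,…,N}}` are i.i.d. standard Gaussian. The joint law
for different `N` is arbitrary. -/
structure IsDisorder {Ω : Type*} [MeasurableSpace Ω] (P : Measure Ω)
    (J : (N : ℕ) → Finset (Fin N) → Ω → ℝ) : Prop where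
  gaussian : ∀ N α, HasLaw (J N α) (gaussianReal 0 1) P
  indep : ∀ N, iIndepFun (J N) P

/-- The realisation of all samples `N = 0, 1, …` from one sequence `(W_ℓ)_{ℓ ≥ 1}` of i.i.d.
exponential variables of mean one: `log (U_{ℓ+1,n} / U_{ℓ,n}) = W_ℓ / ℓ` for every `N`,
`n = 2^N`. -/
structure IsCoupling {Ω : Type*} [MeasurableSpace Ω] (P : Measure Ω)
    (J : (N : ℕ) → Finset (Fin N) → Ω → ℝ) (W : ℕ → Ω → ℝ) : Prop where
  disorder : IsDisorder P J
  exponential : ∀ l, 1 ≤ l → HasLaw (W l) (expMeasure 1) P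
  indep : iIndepFun (fun l : ℕ => W (l + 1)) P
  link : ∀ᵐ ω ∂P, ∀ N l, 1 ≤ l → l ≤ 2 ^ N → spacing (fun α => J N α ω) l = W l ω

end REM

end

namespace REM

/-! The matrix of normalised characters is orthogonal, so the energies X_σ are i.i.d. standard
Gaussian. Ranking the configurations turns the Gibbs measure into weights exp(-β√N (X_j - X_1)), and
since β_c √N = √(2 log 2^N), μ^(1)_k is exactly this measure conditioned on the k lowest ranks.

The lower bounds come from `le_tvDist_truncated`, for weights w ≤ 1 on ranks counted from 0. A
measure on the first k ranks misses the mass of the ranks from k on, which is at least w_k / ∑_{i ≤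
k} w_i. A test function with values ±1 doubles it, and the factor 2 absorbs w_0 + w_1 ≤ 2, leaving
w_k / (1 + ∑_{2 ≤ i ≤ k} w_i). This is why ζ starts at j = 2.

To pass from energy gaps to spacings, Borel-Cantelli shows that every fixed rank has energy
asymptotic to -L, L = √(2 log 2^N) (`IsDisorder.ae_tendsto_sortedEnergy_div`); this works for any
joint law in N. Near -L the Mills ratio gives log Φ slope L to first order, so L (X_j - X_1) and log
(U_j / U_1) agree up to a small relative error and the weights differ by o(1)
(`tendsto_boltzmann_sub_zetaTerm`). Non-convergence to 0 follows because U_1 and U_{k+1} are both of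
order 2^{-N} with probability close to 1 (`IsDisorder.ae_not_tendsto_zetaTerm_zero`).

For exponential W, the expectation of the j-th term of ζ is ∏_{l ≤ j} (1 + β/(β_c l))⁻¹, of order
j^{-β/β_c}, which is summable as β > β_c. The coupling is built upwards in the sample size: a
uniform sample of size n + 1 is one of size n, shrunk by an independent maximum exp(-W/(n+1)) that
is inserted at a uniform position (`map_insertMax`). Shrinking preserves ratios, so the earlier
spacings never change. -/

/-! ### Orthogonality of the characters and independence of the energies. -/

/-- Jointly Gaussian variables with identity covariance are independent. Serves in both directions:
from couplings to energies, and from constructed energies back to couplings. -/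
theorem iid_gaussian_of_mul_transpose_eq_one {Ω ι κ : Type*} [MeasurableSpace Ω] {P : Measure Ω}
    [IsProbabilityMeasure P] [Fintype ι] [Fintype κ] [DecidableEq κ] {X : ι → Ω → ℝ}
    (hX : ∀ i, HasLaw (X i) (gaussianReal 0 1) P) (hI : iIndepFun X P)
    (A : Matrix κ ι ℝ) (hA : A * A.transpose = 1) :
    (∀ k, HasLaw (fun ω => ∑ i, A k i * X i ω) (gaussianReal 0 1) P) ∧
      iIndepFun (fun k ω => ∑ i, A k i * X i ω) P := by
  classical
  have hm : ∀ i, MemLp (X i) 2 P := fun i => (hX i).hasGaussianLaw.memLp_two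
  have hcov : ∀ k l, cov[fun ω => ∑ i, A k i * X i ω, fun ω => ∑ i, A l i * X i ω; P] =
      (1 : Matrix κ κ ℝ) k l := by
    intro k l
    rw [covariance_fun_sum_fun_sum (fun i => (hm i).const_mul _) (fun i => (hm i).const_mul _)]
    simp_rw [covariance_const_mul_left, covariance_const_mul_right]
    have h : ∀ i j, cov[X i, X j; P] = if i = j then 1 else 0 := by
      intro i j
      split_ifs with hij
      · subst hij
        rw [covariance_self (hX i).aemeasurable, (hX i).variance_eq, variance_id_gaussianReal]
        simp
      · exact (hI.indepFun hij).covariance_eq_zero (hm i) (hm j)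
    simp [h, ← hA, Matrix.mul_apply]
  have hJ := iIndepFun.hasGaussianLaw (fun i => (hX i).hasGaussianLaw) hI
  let L : (ι → ℝ) →L[ℝ] (κ → ℝ) := LinearMap.toContinuousLinearMap (Matrix.mulVecLin A)
  have hY : HasGaussianLaw (fun ω k => ∑ i, A k i * X i ω) P := by
    exact hJ.map_fun L
  refine ⟨fun k => ⟨(hY.eval k).aemeasurable, ?_⟩, ?_⟩
  · rw [(hY.eval k).map_eq_gaussianReal, ← covariance_self (hY.eval k).aemeasurable, hcov k k,
      integral_finsetSum _ fun i _ => ((hX i).hasGaussianLaw.integrable.const_mul _)]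
    have h0 : ∀ i, ∫ ω, X i ω ∂P = 0 := fun i => by
      rw [(hX i).integral_eq]; simp
    simp [integral_const_mul, h0]
  · exact hY.iIndepFun_of_covariance_eq_zero fun k l hkl => by simp [hcov, hkl]

/-- The orthogonal matrix of normalised characters, `energy J σ = ∑ α, charMatrix N σ α * J α`. -/
noncomputable def charMatrix (N : ℕ) : Matrix (SpinConfig N) (Finset (Fin N)) ℝ :=
  fun σ α => -(1 / (2 : ℝ) ^ ((N : ℝ) / 2)) * spinProd σ α

theorem energy_eq_sum_charMatrix {N : ℕ} (J : Finset (Fin N) → ℝ) (σ : SpinConfig N) :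
    energy J σ = ∑ α, charMatrix N σ α * J α := by
  unfold energy charMatrix
  rw [Finset.mul_sum]
  exact Finset.sum_congr rfl fun α _ => by ring

/-- The sum is the expansion of ∏ (1 + σ_i τ_i); a site where the spins differ gives a factor 0. -/
theorem sum_spinProd_mul_spinProd {N : ℕ} (σ τ : SpinConfig N) :
    ∑ α : Finset (Fin N), spinProd σ α * spinProd τ α = if σ = τ then (2 : ℝ) ^ N else 0 := by
  have h : ∑ α : Finset (Fin N), spinProd σ α * spinProd τ α =
      ∏ i, (1 + ((σ i : ℤ) : ℝ) * ((τ i : ℤ) : ℝ)) := by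
    rw [Finset.prod_one_add, Finset.powerset_univ]
    simp [spinProd, Finset.prod_mul_distrib]
  rw [h]
  split_ifs with hst
  · subst hst
    have : ∀ i, (1 + ((σ i : ℤ) : ℝ) * ((σ i : ℤ) : ℝ)) = 2 := fun i => by
      rcases Int.units_eq_one_or (σ i) with h | h <;> rw [h] <;> norm_num
    simp [this]
  · obtain ⟨i, hi⟩ := Function.ne_iff.1 hst
    apply Finset.prod_eq_zero (Finset.mem_univ i)
    rcases Int.units_eq_one_or (σ i) with h | h <;> rcases Int.units_eq_one_or (τ i) with h' | h'
      <;> first | exact absurd (h.trans h'.symm) hi | (rw [h, h']; norm_num)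

theorem charMatrix_mul_transpose (N : ℕ) : charMatrix N * (charMatrix N).transpose = 1 := by
  ext σ τ
  have h2 : (2 : ℝ) ^ ((N : ℝ) / 2) * (2 : ℝ) ^ ((N : ℝ) / 2) = 2 ^ N := by
    rw [← Real.rpow_add two_pos, add_halves, Real.rpow_natCast]
  have h0 : (2 : ℝ) ^ ((N : ℝ) / 2) ≠ 0 := (Real.rpow_pos_of_pos two_pos _).ne'
  have : (charMatrix N * (charMatrix N).transpose) σ τ =
      (1 / 2 ^ N) * ∑ α : Finset (Fin N), spinProd σ α * spinProd τ α := by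
    rw [Matrix.mul_apply, Finset.mul_sum, ← h2]
    refine Finset.sum_congr rfl fun α _ => ?_
    simp only [charMatrix, Matrix.transpose_apply]
    field_simp
  rw [this, sum_spinProd_mul_spinProd, Matrix.one_apply]
  split_ifs <;> simp

theorem charMatrix_transpose_mul (N : ℕ) : (charMatrix N).transpose * charMatrix N = 1 := by
  have h : Fintype.card (SpinConfig N) = Fintype.card (Finset (Fin N)) := by
    rw [card_spinConfig]; simp
  exact (Matrix.mul_eq_one_comm_of_equiv (Fintype.equivOfCardEq h)).1 (charMatrix_mul_transpose N)

theorem IsDisorder.iid_energy {Ω : Type*} [MeasurableSpace Ω] {P : Measure Ω}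
    [IsProbabilityMeasure P] {J : (N : ℕ) → Finset (Fin N) → Ω → ℝ} (hJ : IsDisorder P J) (N : ℕ) :
    (∀ σ : SpinConfig N, HasLaw (fun ω => energy (fun α => J N α ω) σ) (gaussianReal 0 1) P) ∧
      iIndepFun (fun (σ : SpinConfig N) ω => energy (fun α => J N α ω) σ) P := by
  simp_rw [energy_eq_sum_charMatrix]
  exact iid_gaussian_of_mul_transpose_eq_one (hJ.gaussian N) (hJ.indep N) _
    (charMatrix_mul_transpose N)

/-! ### Total variation distance between truncated measures. -/

theorem abs_sum_mul_sub_le {N : ℕ} (μ ν Ψ : SpinConfig N → ℝ) (hΨ : ‖Ψ‖ = 1) :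
    |∑ σ, Ψ σ * μ σ - ∑ σ, Ψ σ * ν σ| ≤ ∑ σ, |μ σ| + ∑ σ, |ν σ| := by
  have h1 : ∀ σ, |Ψ σ| ≤ 1 := fun σ => by
    rw [← hΨ, ← Real.norm_eq_abs]; exact norm_le_pi_norm Ψ σ
  have h2 : ∀ ρ : SpinConfig N → ℝ, |∑ σ, Ψ σ * ρ σ| ≤ ∑ σ, |ρ σ| := fun ρ =>
    (Finset.abs_sum_le_sum_abs _ _).trans <| Finset.sum_le_sum fun σ _ => by
      rw [abs_mul]; exact mul_le_of_le_one_left (abs_nonneg _) (h1 σ)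
  exact (abs_sub _ _).trans (add_le_add (h2 μ) (h2 ν))

theorem tvDist_le_two {N : ℕ} {μ ν : SpinConfig N → ℝ} (hμ : ∀ σ, 0 ≤ μ σ) (hν : ∀ σ, 0 ≤ ν σ)
    (hμ1 : ∑ σ, μ σ ≤ 1) (hν1 : ∑ σ, ν σ ≤ 1) : tvDist μ ν ≤ 2 := by
  refine Real.sSup_le ?_ zero_le_two
  rintro r ⟨Ψ, hΨ, rfl⟩
  refine (abs_sum_mul_sub_le μ ν Ψ hΨ).trans ?_
  simp_rw [abs_of_nonneg (hμ _), abs_of_nonneg (hν _)]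
  linarith

theorem tvDist_comm {N : ℕ} (μ ν : SpinConfig N → ℝ) : tvDist μ ν = tvDist ν μ := by
  unfold tvDist
  simp_rw [abs_sub_comm (∑ σ, _ * μ σ)]

/-- A measure supported on `S` is at distance at least `2 μ(Sᶜ)` from `μ`. -/
theorem two_mul_sum_compl_le_tvDist {N : ℕ} {μ ν : SpinConfig N → ℝ} (S : Finset (SpinConfig N))
    (hμ : ∑ σ, μ σ = 1) (hν : ∑ σ, ν σ = 1) (hS : ∀ σ, σ ∉ S → ν σ = 0) :
    2 * ∑ σ ∈ Sᶜ, μ σ ≤ tvDist μ ν := by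
  classical
  let Ψ : SpinConfig N → ℝ := fun σ => if σ ∈ S then -1 else 1
  have hΨ : ‖Ψ‖ = 1 := by
    have h : ∀ σ, ‖Ψ σ‖ = 1 := fun σ => by simp only [Ψ]; split_ifs <;> simp
    refine le_antisymm ((pi_norm_le_iff_of_nonneg zero_le_one).2 fun σ => (h σ).le) ?_
    rw [← h 1]; exact norm_le_pi_norm Ψ 1
  have key : ∀ ρ : SpinConfig N → ℝ, ∑ σ, Ψ σ * ρ σ = 2 * ∑ σ ∈ Sᶜ, ρ σ - ∑ σ, ρ σ := fun ρ => by
    rw [← Finset.sum_add_sum_compl S (fun σ => Ψ σ * ρ σ), ← Finset.sum_add_sum_compl S ρ,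
      Finset.sum_congr rfl (g := fun σ => -ρ σ) (fun σ hσ => by simp [Ψ, hσ]),
      Finset.sum_congr (s₁ := Sᶜ) rfl (g := fun σ => ρ σ)
        (fun σ hσ => by simp [Ψ, Finset.mem_compl.1 hσ]), Finset.sum_neg_distrib]
    ring
  have hν0 : ∑ σ ∈ Sᶜ, ν σ = 0 := Finset.sum_eq_zero fun σ hσ => hS σ (Finset.mem_compl.1 hσ)
  refine (le_abs_self _).trans (le_csSup ⟨∑ σ, |μ σ| + ∑ σ, |ν σ|, ?_⟩ ⟨Ψ, hΨ, ?_⟩)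
  · rintro r ⟨Ψ', h', rfl⟩
    exact abs_sum_mul_sub_le μ ν Ψ' h'
  · rw [key, key, hμ, hν, hν0]
    ring_nf

theorem truncated_ranked {N : ℕ} (x : SpinConfig N → ℝ) (w : Fin (2 ^ N) → ℝ) (k : ℕ)
    (i : Fin (2 ^ N)) : truncated x w k (ranked x i) =
      if (i : ℕ) < k then w i / ∑ i ∈ Finset.univ.filter (fun i : Fin (2 ^ N) => (i : ℕ) < k), w i
      else 0 := by
  simp [truncated]

theorem truncated_nonneg {N : ℕ} (x : SpinConfig N → ℝ) {w : Fin (2 ^ N) → ℝ} (hw : ∀ i, 0 ≤ w i)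
    (k : ℕ) (σ : SpinConfig N) : 0 ≤ truncated x w k σ := by
  unfold truncated
  split_ifs
  · exact div_nonneg (hw _) (Finset.sum_nonneg fun i _ => hw i)
  · exact le_rfl

theorem sum_filter_val_pos {N : ℕ} {w : Fin (2 ^ N) → ℝ} (hw : ∀ i, 0 < w i) {k : ℕ}
    (hk : 1 ≤ k) : 0 < ∑ i ∈ Finset.univ.filter (fun i : Fin (2 ^ N) => (i : ℕ) < k), w i :=
  Finset.sum_pos (fun i _ => hw i) ⟨firstRank N, by simp [firstRank]; omega⟩

theorem sum_truncated {N : ℕ} (x : SpinConfig N → ℝ) {w : Fin (2 ^ N) → ℝ} (hw : ∀ i, 0 < w i)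
    {k : ℕ} (hk : 1 ≤ k) : ∑ σ, truncated x w k σ = 1 := by
  rw [← Equiv.sum_comp (ranked x)]
  simp_rw [truncated_ranked]
  rw [← Finset.sum_filter, ← Finset.sum_div, div_self (sum_filter_val_pos hw hk).ne']

theorem tvDist_truncated_le_two {N : ℕ} (x : SpinConfig N → ℝ) {w u : Fin (2 ^ N) → ℝ}
    (hw : ∀ i, 0 < w i) (hu : ∀ i, 0 < u i) {k m : ℕ} (hk : 1 ≤ k) (hm : 1 ≤ m) :
    tvDist (truncated x w k) (truncated x u m) ≤ 2 :=
  tvDist_le_two (truncated_nonneg x (fun i => (hw i).le) k)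
    (truncated_nonneg x (fun i => (hu i).le) m) (sum_truncated x hw hk).le (sum_truncated x hu hm).le

theorem le_tvDist_truncated {N : ℕ} (x : SpinConfig N → ℝ) {w : ℕ → ℝ} {u : Fin (2 ^ N) → ℝ}
    (hw : ∀ i, 0 < w i) (hw1 : ∀ i, w i ≤ 1) (hu : ∀ i, 0 < u i) {k m : ℕ} (hk : 1 ≤ k)
    (hkm : k < m) (hkN : k < 2 ^ N) :
    w k / (1 + ∑ i ∈ Finset.Ico 2 (k + 1), w i) ≤
      tvDist (truncated x (fun i => w i) m) (truncated x u k) := by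
  classical
  let S : Finset (SpinConfig N) := Finset.univ.filter fun σ => ((ranked x).symm σ : ℕ) < k
  have h := two_mul_sum_compl_le_tvDist S (sum_truncated x (fun i => hw i) (by omega : 1 ≤ m))
    (sum_truncated x hu hk) (fun σ hσ => by
      have : ¬ ((ranked x).symm σ : ℕ) < k := by simpa [S] using hσ
      simp [truncated, this])
  refine le_trans ?_ h
  have hB : ∑ σ ∈ Sᶜ, truncated x (fun i => w i) m σ =
      (∑ i ∈ Finset.univ.filter (fun i : Fin (2 ^ N) => k ≤ i ∧ (i : ℕ) < m), w i) /
        ∑ i ∈ Finset.univ.filter (fun i : Fin (2 ^ N) => (i : ℕ) < m), w i := by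
    have hS : Sᶜ = Finset.univ.filter fun σ => k ≤ ((ranked x).symm σ : ℕ) := by
      ext σ; simp [S]
    rw [hS, Finset.sum_filter, ← Equiv.sum_comp (ranked x)]
    simp_rw [truncated_ranked, Equiv.symm_apply_apply, ← ite_and]
    rw [← Finset.sum_filter, Finset.sum_div]
  have hA : ∑ i ∈ Finset.univ.filter (fun i : Fin (2 ^ N) => (i : ℕ) < m), w i =
      ∑ i ∈ Finset.range k, w i +
        ∑ i ∈ Finset.univ.filter (fun i : Fin (2 ^ N) => k ≤ i ∧ (i : ℕ) < m), w i := by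
    have h1 : ∑ i ∈ Finset.range k, w i =
        ∑ i ∈ Finset.univ.filter (fun i : Fin (2 ^ N) => (i : ℕ) < k), w i := by
      symm
      refine Finset.sum_bij (fun i _ => (i : ℕ)) (fun i hi => by simpa using hi)
        (fun i _ j _ h => Fin.ext h) (fun j hj => ?_) (fun _ _ => rfl)
      have := Finset.mem_range.1 hj
      exact ⟨⟨j, by omega⟩, by simpa using this, rfl⟩
    rw [h1, ← Finset.sum_union]
    · congr 1
      ext i
      simp only [Finset.mem_filter, Finset.mem_univ, true_and, Finset.mem_union]
      omega
    · rw [Finset.disjoint_filter]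
      intro i _ h1 h2
      omega
  have hBk : w k ≤ ∑ i ∈ Finset.univ.filter (fun i : Fin (2 ^ N) => k ≤ i ∧ (i : ℕ) < m), w i :=
    Finset.single_le_sum (f := fun i : Fin (2 ^ N) => w i) (fun i _ => (hw i).le)
      (Finset.mem_filter.2 ⟨Finset.mem_univ ⟨k, hkN⟩, le_rfl, hkm⟩)
  -- The ranks 0 and 1 contribute at most 1 each, which the leading constant 2 covers.
  have hA2 : ∑ i ∈ Finset.range k, w i + w k ≤
      2 * (1 + ∑ i ∈ Finset.Ico 2 (k + 1), w i) := by
    rw [← Finset.sum_range_succ, ← Finset.sum_range_add_sum_Ico _ (by omega : 2 ≤ k + 1),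
      Finset.sum_range_succ, Finset.sum_range_one]
    have := Finset.sum_nonneg (s := Finset.Ico 2 (k + 1)) (fun i _ => (hw i).le)
    linarith [hw1 0, hw1 1]
  have hA0 : 0 ≤ ∑ i ∈ Finset.range k, w i := Finset.sum_nonneg fun i _ => (hw i).le
  have hZ : 0 ≤ ∑ i ∈ Finset.Ico 2 (k + 1), w i := Finset.sum_nonneg fun i _ => (hw i).le
  rw [hB, hA]
  generalize ∑ i ∈ Finset.univ.filter (fun i : Fin (2 ^ N) => k ≤ i ∧ (i : ℕ) < m), w i = B at *
  generalize ∑ i ∈ Finset.range k, w i = A at *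
  generalize ∑ i ∈ Finset.Ico 2 (k + 1), w i = Z at *
  have hk0 := hw k
  rw [mul_div_assoc', div_le_div_iff₀ (by linarith) (by linarith)]
  -- With w_k ≤ B: w_k (A + B) ≤ B (A + w_k) ≤ 2 B (1 + Z).
  nlinarith [mul_le_mul_of_nonneg_left hBk hA0, mul_le_mul_of_nonneg_left hA2 (hk0.le.trans hBk)]

/-! ### Gibbs weights as functions of the rank. -/

theorem betaC_pos : 0 < betaC := Real.sqrt_pos.2 (mul_pos two_pos (Real.log_pos one_lt_two))

/-- The order statistics of the energies, counted from `0` and constant beyond rank `2^N - 1`. -/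
noncomputable def sortedEnergy {N : ℕ} (J : Finset (Fin N) → ℝ) (i : ℕ) : ℝ :=
  energy J (ranked (energy J) ⟨min i (2 ^ N - 1),
    lt_of_le_of_lt (min_le_right _ _) (Nat.sub_lt (by positivity) one_pos)⟩)

theorem sortedEnergy_val {N : ℕ} (J : Finset (Fin N) → ℝ) (i : Fin (2 ^ N)) :
    sortedEnergy J i = energy J (ranked (energy J) i) := by
  unfold sortedEnergy
  congr 2
  ext
  simp
  omega

theorem sortedEnergy_mono {N : ℕ} (J : Finset (Fin N) → ℝ) : Monotone (sortedEnergy J) :=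
  fun _ _ hij => monotone_ranked (energy J) (Fin.mk_le_mk.2 (min_le_min_right _ hij))

/-- `√(2 log 2^N)`. -/
noncomputable def energyScale (N : ℕ) : ℝ := Real.sqrt (2 * Real.log ((2 : ℝ) ^ N))

theorem energyScale_eq (N : ℕ) : energyScale N = betaC * Real.sqrt N := by
  unfold energyScale betaC
  rw [Real.log_pow, ← Real.sqrt_mul (mul_pos two_pos (Real.log_pos one_lt_two)).le]
  ring_nf

/-- The Gibbs weights relative to the ground state, by rank. -/
noncomputable def boltzmann {N : ℕ} (β : ℝ) (J : Finset (Fin N) → ℝ) (i : ℕ) : ℝ :=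
  Real.exp (-(β / betaC) * energyScale N * (sortedEnergy J i - sortedEnergy J 0))

theorem boltzmann_pos {N : ℕ} (β : ℝ) (J : Finset (Fin N) → ℝ) (i : ℕ) : 0 < boltzmann β J i :=
  Real.exp_pos _

theorem boltzmann_le_one {N : ℕ} {β : ℝ} (hβ : 0 ≤ β) (J : Finset (Fin N) → ℝ) (i : ℕ) :
    boltzmann β J i ≤ 1 := by
  have h1 := sortedEnergy_mono J (Nat.zero_le i)
  have h2 : 0 ≤ β / betaC * energyScale N :=
    mul_nonneg (div_nonneg hβ betaC_pos.le) (Real.sqrt_nonneg _)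
  refine Real.exp_le_one_iff.2 ?_
  nlinarith [mul_nonneg h2 (sub_nonneg.2 h1)]

theorem truncGibbs_eq {N : ℕ} (β : ℝ) (J : Finset (Fin N) → ℝ) (k : ℕ) :
    truncGibbs β J k = truncated (energy J) (fun i => boltzmann β J i) k := by
  unfold truncGibbs boltzmann energyScale
  have h0 : sortedEnergy J 0 = energy J (ranked (energy J) (firstRank N)) :=
    sortedEnergy_val J (firstRank N)
  simp_rw [sortedEnergy_val, h0]

/-- The ground state factor cancels between weight and partition function, and a cut at `2 ^ N`
removes nothing. -/
theorem gibbs_eq_truncated {N : ℕ} (β : ℝ) (J : Finset (Fin N) → ℝ) :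
    gibbs β J = truncated (energy J) (fun i => boltzmann β J i) (2 ^ N) := by
  have key : ∀ i : Fin (2 ^ N), Real.exp (-β * hamiltonian J (ranked (energy J) i)) =
      Real.exp (-β * Real.sqrt N * sortedEnergy J 0) * boltzmann β J i := fun i => by
    unfold boltzmann
    rw [← Real.exp_add, hamiltonian_eq, energyScale_eq, ← sortedEnergy_val]
    have := betaC_pos.ne'
    congr 1
    field_simp
    ring
  funext σ
  obtain ⟨i, rfl⟩ := (ranked (energy J)).surjective σ
  rw [truncated_ranked, if_pos i.2, gibbs, partitionFunction, ← Equiv.sum_comp (ranked (energy J))]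
  simp_rw [key]
  rw [← Finset.mul_sum, mul_div_mul_left _ _ (Real.exp_pos _).ne']
  simp

theorem zetaTerm_pos (β : ℝ) (W : ℕ → ℝ) (j : ℕ) : 0 < zetaTerm β W j := Real.exp_pos _

theorem truncExp_eq {N : ℕ} (β : ℝ) (J : Finset (Fin N) → ℝ) (W : ℕ → ℝ) (k : ℕ) :
    truncExp β J W k = truncated (energy J) (fun i => zetaTerm β W i) k := rfl

/-! ### The Gaussian distribution function and Mills ratio bounds. -/

/-- The standard Gaussian distribution function. -/
noncomputable abbrev stdCdf (x : ℝ) : ℝ := cdf (gaussianReal 0 1) x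

/-- The standard Gaussian density. -/
noncomputable abbrev stdPdf (x : ℝ) : ℝ := gaussianPDFReal 0 1 x

theorem stdPdf_eq (x : ℝ) : stdPdf x = (Real.sqrt (2 * Real.pi))⁻¹ * Real.exp (-x ^ 2 / 2) := by
  simp [stdPdf, gaussianPDFReal]

theorem stdPdf_pos (x : ℝ) : 0 < stdPdf x := gaussianPDFReal_pos 0 1 x one_ne_zero

theorem hasDerivAt_stdPdf (x : ℝ) : HasDerivAt stdPdf (-x * stdPdf x) x := by
  have h : stdPdf = fun x => (Real.sqrt (2 * Real.pi))⁻¹ * Real.exp (-x ^ 2 / 2) :=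
    funext stdPdf_eq
  rw [stdPdf_eq x, h]
  have h1 : HasDerivAt (fun x : ℝ => -x ^ 2 / 2) (-x) x := by
    have := ((hasDerivAt_pow 2 x).neg).div_const 2
    refine this.congr_deriv ?_
    simp; ring
  exact (h1.exp.const_mul _).congr_deriv (by ring)

theorem continuous_stdPdf : Continuous stdPdf :=
  continuous_iff_continuousAt.2 fun x => (hasDerivAt_stdPdf x).continuousAt

theorem stdCdf_eq_integral (x : ℝ) : stdCdf x = ∫ t in Set.Iic x, stdPdf t := by
  rw [stdCdf, cdf_eq_real, measureReal_def, gaussianReal_apply_eq_integral 0 one_ne_zero,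
    ENNReal.toReal_ofReal]
  exact integral_nonneg fun t => gaussianPDFReal_nonneg 0 1 t

theorem hasDerivAt_stdCdf (x : ℝ) : HasDerivAt stdCdf (stdPdf x) x := by
  have hi : Integrable stdPdf := integrable_gaussianPDFReal 0 1
  have h : stdCdf = fun x => stdCdf 0 + ∫ t in (0 : ℝ)..x, stdPdf t := by
    funext y
    rw [stdCdf_eq_integral, stdCdf_eq_integral,
      ← intervalIntegral.integral_Iic_sub_Iic hi.integrableOn hi.integrableOn]
    ring
  rw [h]
  exact (intervalIntegral.integral_hasDerivAt_right hi.intervalIntegrable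
    (continuous_stdPdf.stronglyMeasurableAtFilter _ _) continuous_stdPdf.continuousAt).const_add _

theorem continuous_stdCdf : Continuous stdCdf :=
  continuous_iff_continuousAt.2 fun x => (hasDerivAt_stdCdf x).continuousAt

theorem strictMono_stdCdf : StrictMono stdCdf :=
  strictMono_of_deriv_pos fun x => by rw [(hasDerivAt_stdCdf x).deriv]; exact stdPdf_pos x

theorem stdCdf_pos (x : ℝ) : 0 < stdCdf x :=
  (cdf_nonneg _ (x - 1)).trans_lt (strictMono_stdCdf (sub_one_lt x))

theorem stdCdf_lt_one (x : ℝ) : stdCdf x < 1 :=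
  (strictMono_stdCdf (lt_add_one x)).trans_le (cdf_le_one _ _)

theorem range_stdCdf : Set.range stdCdf = Set.Ioo 0 1 := by
  refine Set.Subset.antisymm ?_ fun u hu => ?_
  · rintro _ ⟨x, rfl⟩
    exact ⟨stdCdf_pos x, stdCdf_lt_one x⟩
  · obtain ⟨a, ha⟩ := ((tendsto_cdf_atBot (gaussianReal 0 1)).eventually_lt_const hu.1).exists
    obtain ⟨b, hb⟩ := ((tendsto_cdf_atTop (gaussianReal 0 1)).eventually_const_lt hu.2).exists
    exact mem_range_of_exists_le_of_exists_ge continuous_stdCdf ⟨a, ha.le⟩ ⟨b, hb.le⟩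

theorem tendsto_stdPdf_atBot : Tendsto stdPdf atBot (𝓝 0) := by
  have h : stdPdf = fun x => (Real.sqrt (2 * Real.pi))⁻¹ * Real.exp (-x ^ 2 / 2) :=
    funext stdPdf_eq
  rw [h, ← mul_zero (Real.sqrt (2 * Real.pi))⁻¹]
  refine Tendsto.const_mul _ (Real.tendsto_exp_atBot.comp ?_)
  have h2 : Tendsto (fun x : ℝ => x ^ 2) atBot atTop := by
    simpa [sq] using (tendsto_id (α := ℝ) (x := atBot)).atBot_mul_atBot₀ tendsto_id
  exact (tendsto_neg_atTop_atBot.comp h2).atBot_div_const two_pos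

/-- The difference φ(z)/(-z) - Φ(z) vanishes at -∞ and has derivative φ(z)/z² on the negative axis.
-/
theorem stdCdf_mul_le (x : ℝ) (hx : x < 0) : stdCdf x * (-x) ≤ stdPdf x := by
  let u : ℝ → ℝ := fun z => stdPdf z * (-z)⁻¹ - stdCdf z
  have hu : ∀ z < 0, HasDerivAt u (stdPdf z / z ^ 2) z := fun z hz => by
    have h1 : HasDerivAt (fun z : ℝ => (-z)⁻¹) (1 / z ^ 2) z := by
      have := (hasDerivAt_neg z).inv (neg_ne_zero.2 hz.ne)
      refine this.congr_deriv ?_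
      simp
    refine (((hasDerivAt_stdPdf z).mul h1).sub (hasDerivAt_stdCdf z)).congr_deriv ?_
    have := hz.ne
    field_simp
    ring
  have hmono : MonotoneOn u (Set.Iio 0) := by
    refine monotoneOn_of_deriv_nonneg (convex_Iio 0)
      (fun z hz => (hu z hz).continuousAt.continuousWithinAt) ?_ ?_ <;> rw [interior_Iio]
    · exact fun z hz => (hu z hz).differentiableAt.differentiableWithinAt
    · intro z hz
      rw [(hu z hz).deriv]
      exact div_nonneg (stdPdf_pos z).le (sq_nonneg z)
  have hlim : Tendsto u atBot (𝓝 0) := by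
    have h1 : Tendsto (fun z : ℝ => (-z)⁻¹) atBot (𝓝 0) :=
      tendsto_inv_atTop_zero.comp tendsto_neg_atBot_atTop
    have h2 := (tendsto_stdPdf_atBot.mul h1).sub (tendsto_cdf_atBot (gaussianReal 0 1))
    rwa [mul_zero, sub_zero] at h2
  have h0 : 0 ≤ u x := le_of_tendsto hlim <| (eventually_le_atBot x).mono fun z hz =>
    hmono (hz.trans_lt hx) hx hz
  have h1 : stdCdf x ≤ stdPdf x * (-x)⁻¹ := sub_nonneg.1 h0
  rwa [← div_eq_mul_inv, le_div_iff₀ (neg_pos.2 hx)] at h1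

/-- The same argument for Φ(z) - φ(z)(-z)/(1 + z²), whose derivative is 2φ(z)/(1 + z²)². -/
theorem le_stdCdf_mul (x : ℝ) : stdPdf x * (-x) ≤ stdCdf x * (1 + x ^ 2) := by
  let g : ℝ → ℝ := fun z => stdCdf z - stdPdf z * (-z / (1 + z ^ 2))
  have hp : ∀ z : ℝ, 0 < 1 + z ^ 2 := fun z => by positivity
  have hg : ∀ z, HasDerivAt g (stdPdf z * (2 / (1 + z ^ 2) ^ 2)) z := fun z => by
    have h1 : HasDerivAt (fun z : ℝ => -z / (1 + z ^ 2))
        ((-1 * (1 + z ^ 2) - (-z) * (2 * z)) / (1 + z ^ 2) ^ 2) z := by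
      have h2 : HasDerivAt (fun z : ℝ => 1 + z ^ 2) (2 * z) z := by
        simpa using (hasDerivAt_pow 2 z).const_add 1
      exact (hasDerivAt_neg z).div h2 (hp z).ne'
    refine ((hasDerivAt_stdCdf z).sub ((hasDerivAt_stdPdf z).mul h1)).congr_deriv ?_
    have := (hp z).ne'
    field_simp
    ring
  have hmono : Monotone g := monotone_of_deriv_nonneg (fun z => (hg z).differentiableAt) fun z => by
    rw [(hg z).deriv]
    exact mul_nonneg (stdPdf_pos z).le (div_nonneg zero_le_two (sq_nonneg _))
  have hlim : Tendsto g atBot (𝓝 0) := by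
    have h1 : Tendsto (fun z => stdPdf z * (-z / (1 + z ^ 2))) atBot (𝓝 0) := by
      refine squeeze_zero_norm (fun z => ?_) tendsto_stdPdf_atBot
      rw [norm_mul, Real.norm_eq_abs, Real.norm_eq_abs, abs_of_pos (stdPdf_pos z)]
      refine mul_le_of_le_one_right (stdPdf_pos z).le ?_
      rw [abs_div, abs_neg, abs_of_pos (hp z), div_le_one (hp z)]
      nlinarith [sq_nonneg (|z| - 1), sq_abs z, abs_nonneg z]
    simpa using (tendsto_cdf_atBot (gaussianReal 0 1)).sub h1
  have h0 : 0 ≤ g x := hmono.le_of_tendsto hlim x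
  have h1 : stdPdf x * (-x / (1 + x ^ 2)) ≤ stdCdf x := sub_nonneg.1 h0
  rwa [mul_div_assoc', div_le_iff₀ (hp x)] at h1

theorem hasDerivAt_log_stdCdf (x : ℝ) :
    HasDerivAt (fun z => Real.log (stdCdf z)) (stdPdf x / stdCdf x) x :=
  (hasDerivAt_stdCdf x).log (stdCdf_pos x).ne'

/-- Mean value bound: (log Φ)' = φ/Φ lies between -z and -z + 1/(-z) for z < 0. The lower half is
used here, the upper half in the next lemma. -/
theorem mul_sub_le_log_stdCdf_sub {x y : ℝ} (hxy : x ≤ y) (hy : y < 0) :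
    -y * (y - x) ≤ Real.log (stdCdf y) - Real.log (stdCdf x) := by
  refine Convex.mul_sub_le_image_sub_of_le_deriv (convex_Icc x y)
    (fun z _ => (hasDerivAt_log_stdCdf z).continuousAt.continuousWithinAt)
    (fun z _ => (hasDerivAt_log_stdCdf z).differentiableAt.differentiableWithinAt)
    (fun z hz => ?_) x (Set.left_mem_Icc.2 hxy) y (Set.right_mem_Icc.2 hxy) hxy
  rw [interior_Icc] at hz
  rw [(hasDerivAt_log_stdCdf z).deriv, le_div_iff₀ (stdCdf_pos z)]
  nlinarith [stdCdf_mul_le z (hz.2.trans hy), stdCdf_pos z, hz.2]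

theorem log_stdCdf_sub_le_mul_sub {x y : ℝ} (hxy : x ≤ y) (hy : y < 0) :
    Real.log (stdCdf y) - Real.log (stdCdf x) ≤ (-x + 1 / (-y)) * (y - x) := by
  refine Convex.image_sub_le_mul_sub_of_deriv_le (convex_Icc x y)
    (fun z _ => (hasDerivAt_log_stdCdf z).continuousAt.continuousWithinAt)
    (fun z _ => (hasDerivAt_log_stdCdf z).differentiableAt.differentiableWithinAt)
    (fun z hz => ?_) x (Set.left_mem_Icc.2 hxy) y (Set.right_mem_Icc.2 hxy) hxy
  rw [interior_Icc] at hz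
  have hz0 : 0 < -z := neg_pos.2 (hz.2.trans hy)
  rw [(hasDerivAt_log_stdCdf z).deriv]
  calc stdPdf z / stdCdf z ≤ -z + 1 / (-z) := by
        rw [div_le_iff₀ (stdCdf_pos z)]
        have h := le_stdCdf_mul z
        rw [← le_div_iff₀ hz0] at h
        refine h.trans_eq ?_
        have := hz0.ne'
        field_simp
        ring
    _ ≤ -x + 1 / (-y) := add_le_add (by linarith [hz.1])
        (one_div_le_one_div_of_le (neg_pos.2 hy) (by linarith [hz.2]))

theorem stdCdf_neg_le {s : ℝ} (hs : 1 ≤ s) : stdCdf (-s) ≤ Real.exp (-s ^ 2 / 2) := by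
  have h := stdCdf_mul_le (-s) (by linarith)
  rw [neg_neg, stdPdf_eq, neg_sq] at h
  have h1 : (Real.sqrt (2 * Real.pi))⁻¹ ≤ 1 := by
    refine inv_le_one_of_one_le₀ (Real.one_le_sqrt.2 ?_)
    linarith [Real.pi_gt_three]
  nlinarith [stdCdf_pos (-s), Real.exp_pos (-s ^ 2 / 2)]

theorem le_stdCdf_neg {s : ℝ} (hs : 1 ≤ s) :
    Real.exp (-s ^ 2 / 2) ≤ 3 * (1 + s ^ 2) * stdCdf (-s) := by
  have h := le_stdCdf_mul (-s)
  rw [neg_neg, stdPdf_eq, neg_sq] at h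
  have h1 : 1 / 3 ≤ (Real.sqrt (2 * Real.pi))⁻¹ := by
    rw [← one_div]
    refine one_div_le_one_div_of_le (Real.sqrt_pos.2 (by positivity)) ?_
    rw [Real.sqrt_le_left (by norm_num)]
    linarith [Real.pi_lt_four]
  have h2 := Real.exp_pos (-s ^ 2 / 2)
  nlinarith [mul_le_mul_of_nonneg_left hs (mul_nonneg (le_trans (by norm_num) h1) h2.le),
    mul_le_mul_of_nonneg_right h1 h2.le]

/-! ### Linearised gaps against logarithmic gaps. -/

/-- Both exponents are at least u/2, so the difference is at most η u e^{-u/2} ≤ 2η. A relative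
error suffices, with no bound on u: the gaps need not be shown to be bounded. -/
theorem abs_exp_neg_sub_exp_neg_le {u v η : ℝ} (hu : 0 ≤ u) (hη0 : 0 ≤ η) (hη : η ≤ 1 / 2)
    (h : |u - v| ≤ η * u) : |Real.exp (-u) - Real.exp (-v)| ≤ 2 * η := by
  obtain ⟨h1, h2⟩ := abs_le.1 h
  have key : ∀ a b : ℝ, u / 2 ≤ a → a ≤ b → b - a ≤ η * u →
      Real.exp (-a) - Real.exp (-b) ≤ 2 * η := by
    intro a b ha hab hb
    have e1 : Real.exp (-a) - Real.exp (-b) = Real.exp (-a) * (1 - Real.exp (-(b - a))) := by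
      rw [mul_sub, mul_one, ← Real.exp_add]; ring_nf
    have e2 : 1 - Real.exp (-(b - a)) ≤ η * u := by
      linarith [Real.add_one_le_exp (-(b - a))]
    have e3 : Real.exp (-a) ≤ Real.exp (-(u / 2)) := Real.exp_le_exp.2 (by linarith)
    have e4 : u / 2 * Real.exp (-(u / 2)) ≤ 1 := by
      rw [Real.exp_neg, ← div_eq_mul_inv, div_le_one (Real.exp_pos _)]
      linarith [Real.add_one_le_exp (u / 2)]
    have e5 : 0 ≤ η * u := (abs_nonneg _).trans h
    rw [e1]
    calc Real.exp (-a) * (1 - Real.exp (-(b - a))) ≤ Real.exp (-(u / 2)) * (η * u) :=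
          mul_le_mul e3 e2 (by
            rw [sub_nonneg, Real.exp_le_one_iff]; linarith) (Real.exp_pos _).le
      _ = 2 * η * (u / 2 * Real.exp (-(u / 2))) := by ring
      _ ≤ 2 * η := mul_le_of_le_one_right (by linarith) e4
  rw [abs_le]
  rcases le_total u v with huv | huv
  · have := key u v (by linarith) huv (by linarith)
    have := Real.exp_le_exp.2 (neg_le_neg huv)
    constructor <;> linarith
  · have := key v u (by nlinarith) huv (by linarith)
    have := Real.exp_le_exp.2 (neg_le_neg huv)
    constructor <;> linarith

/-- The energy gap scaled linearly agrees asymptotically with the logarithmic gap of the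
distribution function, as long as both energies are close to the edge of the spectrum. -/
theorem tendsto_exp_sub_exp_log_stdCdf {x y L : ℕ → ℝ} {a : ℝ} (ha : 0 ≤ a)
    (hL : Tendsto L atTop atTop) (hxy : ∀ n, x n ≤ y n)
    (hx : Tendsto (fun n => x n / L n) atTop (𝓝 (-1)))
    (hy : Tendsto (fun n => y n / L n) atTop (𝓝 (-1))) :
    Tendsto (fun n => Real.exp (-(a * L n * (y n - x n))) -
      Real.exp (-(a * (Real.log (stdCdf (y n)) - Real.log (stdCdf (x n)))))) atTop (𝓝 0) := by
  have hA : Tendsto (fun n => -(y n / L n)) atTop (𝓝 1) := by simpa using hy.neg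
  -- This is the upper slope bound -x + 1/(-y) divided by L.
  have hB : Tendsto (fun n => -(x n / L n) + (-(y n / L n))⁻¹ * (L n * L n)⁻¹) atTop (𝓝 1) := by
    have h1 := (hA.inv₀ one_ne_zero).mul (tendsto_inv_atTop_zero.comp (hL.atTop_mul_atTop₀ hL))
    simpa using hx.neg.add h1
  rw [Metric.tendsto_atTop']
  intro ε hε
  set η := min (ε / 4) (1 / 2) with hη
  have hη0 : 0 < η := lt_min (by linarith) (by norm_num)
  obtain ⟨n₀, h⟩ := eventually_atTop.1 ((hL.eventually_gt_atTop 0).and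
    ((hA.eventually_const_lt (show 1 - η < 1 by linarith)).and
      (hB.eventually_lt_const (show 1 < 1 + η by linarith))))
  refine ⟨n₀, fun n hn => ?_⟩
  obtain ⟨hL0, h1, h2⟩ := h n hn.le
  have hy0 : y n < 0 := by
    have : 0 < -(y n / L n) := by linarith [min_le_right (ε / 4) (1 / 2 : ℝ)]
    rw [← neg_div] at this
    exact neg_pos.1 ((div_pos_iff_of_pos_right hL0).1 this)
  have hd : 0 ≤ y n - x n := sub_nonneg.2 (hxy n)
  have l1 := mul_sub_le_log_stdCdf_sub (hxy n) hy0
  have l2 := log_stdCdf_sub_le_mul_sub (hxy n) hy0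
  have e1 : (1 - η) * L n ≤ -y n := by
    rw [← neg_div, lt_div_iff₀ hL0] at h1; exact h1.le
  have e2 : -x n + 1 / (-y n) ≤ (1 + η) * L n := by
    have : -x n + 1 / (-y n) = (-(x n / L n) + (-(y n / L n))⁻¹ * (L n * L n)⁻¹) * L n := by
      have := hy0.ne
      field_simp
    rw [this]
    exact mul_le_mul_of_nonneg_right h2.le hL0.le
  rw [Real.dist_eq, sub_zero]
  refine (abs_exp_neg_sub_exp_neg_le (by positivity) hη0.le (min_le_right _ _) ?_).trans_lt
    (show 2 * η < ε by linarith [min_le_left (ε / 4) (1 / 2 : ℝ)])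
  rw [abs_le]
  have m1 := mul_le_mul_of_nonneg_left (l1.trans' (mul_le_mul_of_nonneg_right e1 hd)) ha
  have m2 := mul_le_mul_of_nonneg_left (l2.trans (mul_le_mul_of_nonneg_right e2 hd)) ha
  constructor <;> nlinarith

theorem orderedUnif_succ {N : ℕ} (J : Finset (Fin N) → ℝ) {i : ℕ} (hi : i < 2 ^ N) :
    orderedUnif J (i + 1) = stdCdf (sortedEnergy J i) := by
  rw [← Fin.val_mk hi, sortedEnergy_val J ⟨i, hi⟩]
  simp [orderedUnif, hi]

/-- Telescoping, as the l-th spacing over l is log U_{l+1} - log U_l. Rank i counted from 0 is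
U_{i+1}, so for i < 2^N the boundary convention U_{n+1} = 1 does not enter. -/
theorem weightedSum_spacing {N : ℕ} (J : Finset (Fin N) → ℝ) {i : ℕ} (hi : i < 2 ^ N) :
    weightedSum (spacing J) i =
      Real.log (stdCdf (sortedEnergy J i)) - Real.log (stdCdf (sortedEnergy J 0)) := by
  induction i with
  | zero => simp [weightedSum]
  | succ i ih =>
    have hi' : i < 2 ^ N := by omega
    have h : weightedSum (spacing J) (i + 1) =
        weightedSum (spacing J) i + spacing J (i + 1) / ((i + 1 : ℕ) : ℝ) := by
      unfold weightedSum
      rw [Finset.sum_Icc_succ_top (by omega)]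
    rw [h, ih hi', spacing, orderedUnif_succ J hi', orderedUnif_succ J hi, Real.log_pow,
      Real.log_div (stdCdf_pos _).ne' (stdCdf_pos _).ne']
    have : ((i + 1 : ℕ) : ℝ) ≠ 0 := by positivity
    field_simp
    ring

theorem zetaTerm_spacing {N : ℕ} (β : ℝ) (J : Finset (Fin N) → ℝ) {i : ℕ} (hi : i < 2 ^ N) :
    zetaTerm β (spacing J) i = Real.exp (-(β / betaC *
      (Real.log (stdCdf (sortedEnergy J i)) - Real.log (stdCdf (sortedEnergy J 0))))) := by
  rw [zetaTerm, weightedSum_spacing J hi, neg_mul]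

theorem tendsto_energyScale : Tendsto energyScale atTop atTop := by
  have h : energyScale = fun N : ℕ => betaC * Real.sqrt N := funext energyScale_eq
  rw [h]
  exact Tendsto.const_mul_atTop betaC_pos (Real.tendsto_sqrt_atTop.comp tendsto_natCast_atTop_atTop)

theorem tendsto_boltzmann_sub_zetaTerm {β : ℝ} (hβ : 0 ≤ β) {J : (N : ℕ) → Finset (Fin N) → ℝ}
    (h : ∀ i, Tendsto (fun N => sortedEnergy (J N) i / energyScale N) atTop (𝓝 (-1))) (i : ℕ) :
    Tendsto (fun N => boltzmann β (J N) i - zetaTerm β (spacing (J N)) i) atTop (𝓝 0) := by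
  refine (tendsto_exp_sub_exp_log_stdCdf (div_nonneg hβ betaC_pos.le) tendsto_energyScale
    (fun N => sortedEnergy_mono (J N) (Nat.zero_le i)) (h 0) (h i)).congr' ?_
  filter_upwards [(tendsto_pow_atTop_atTop_of_one_lt (one_lt_two : (1:ℕ) < 2)).eventually_gt_atTop i]
    with N hN
  rw [zetaTerm_spacing β (J N) hN, boltzmann]
  ring_nf

/-! ### Lower bounds along a fixed realisation. -/

theorem div_one_add_sub_le {p q s t : ℝ} (hp : 0 ≤ p) (hp1 : p ≤ 1)
    (hs : 0 ≤ s) (ht : 0 ≤ t) : q / (1 + t) - p / (1 + s) ≤ |p - q| + |s - t| := by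
  have e : q / (1 + t) - p / (1 + s) = (q - p) / (1 + t) + p / (1 + s) * ((s - t) / (1 + t)) := by
    have h1 : 1 + s ≠ 0 := by positivity
    have h2 : 1 + t ≠ 0 := by positivity
    field_simp
    ring
  have h1 : (q - p) / (1 + t) ≤ |p - q| := by
    rw [abs_sub_comm, div_le_iff₀ (by linarith)]
    nlinarith [le_abs_self (q - p), abs_nonneg (q - p)]
  have h2 : (s - t) / (1 + t) ≤ |s - t| := by
    rw [div_le_iff₀ (by linarith)]
    nlinarith [le_abs_self (s - t), abs_nonneg (s - t)]
  have h3 : 0 ≤ p / (1 + s) := by positivity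
  have h4 : p / (1 + s) ≤ 1 := by rw [div_le_one (by linarith)]; linarith
  rw [e]
  nlinarith [mul_le_mul_of_nonneg_left h2 h3, abs_nonneg (s - t)]

theorem sum_Ico_zetaTerm_le_zetaPartial {β : ℝ} (W : ℕ → ℝ) {k n : ℕ} (hkn : k < n) :
    ∑ i ∈ Finset.Ico 2 (k + 1), zetaTerm β W i ≤ zetaPartial β W n :=
  Finset.sum_le_sum_of_subset_of_nonneg
    (fun i hi => by simp only [Finset.mem_Ico, Finset.mem_Icc] at hi ⊢; omega)
    fun i _ _ => (zetaTerm_pos β W i).le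

/-- Only the finitely many weights of rank at most k are compared, so no uniformity in the rank is
needed; the full partial sum of ζ enters merely by enlarging the denominator. -/
theorem eventually_sub_le_tvDist_gibbs {β : ℝ} (hβ : 0 ≤ β) {J : (N : ℕ) → Finset (Fin N) → ℝ}
    (h : ∀ i, Tendsto (fun N => sortedEnergy (J N) i / energyScale N) atTop (𝓝 (-1)))
    {k : ℕ} (hk : 1 ≤ k) (u : (N : ℕ) → Fin (2 ^ N) → ℝ) (hu : ∀ N i, 0 < u N i)
    {ε : ℝ} (hε : 0 < ε) : ∀ᶠ N in atTop,
      zetaTerm β (spacing (J N)) k / (1 + zetaPartial β (spacing (J N)) (2 ^ N)) - ε ≤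
        tvDist (gibbs β (J N)) (truncated (energy (J N)) (u N) k) := by
  have hd := tendsto_boltzmann_sub_zetaTerm hβ h
  have hlim : Tendsto (fun N => |boltzmann β (J N) k - zetaTerm β (spacing (J N)) k| +
      |∑ i ∈ Finset.Ico 2 (k + 1), boltzmann β (J N) i -
        ∑ i ∈ Finset.Ico 2 (k + 1), zetaTerm β (spacing (J N)) i|) atTop (𝓝 0) := by
    have h2 := tendsto_finsetSum (Finset.Ico 2 (k + 1)) (fun i _ => hd i)
    simp only [Finset.sum_sub_distrib, Finset.sum_const_zero] at h2
    simpa using (hd k).abs.add h2.abs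
  filter_upwards [hlim.eventually_lt_const hε,
    (tendsto_pow_atTop_atTop_of_one_lt (one_lt_two : (1:ℕ) < 2)).eventually_gt_atTop k]
    with N h1 hN
  have hs : 0 ≤ ∑ i ∈ Finset.Ico 2 (k + 1), boltzmann β (J N) i :=
    Finset.sum_nonneg fun i _ => (boltzmann_pos _ _ _).le
  have ht : 0 ≤ ∑ i ∈ Finset.Ico 2 (k + 1), zetaTerm β (spacing (J N)) i :=
    Finset.sum_nonneg fun i _ => (zetaTerm_pos _ _ _).le
  have h2 := div_one_add_sub_le (q := zetaTerm β (spacing (J N)) k) (boltzmann_pos β (J N) k).le (boltzmann_le_one hβ (J N) k) hs ht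
  have h3 := le_tvDist_truncated (energy (J N)) (boltzmann_pos β (J N))
    (boltzmann_le_one hβ (J N)) (hu N) hk hN hN
  rw [← gibbs_eq_truncated] at h3
  have h4 : zetaTerm β (spacing (J N)) k / (1 + zetaPartial β (spacing (J N)) (2 ^ N)) ≤
      zetaTerm β (spacing (J N)) k / (1 + ∑ i ∈ Finset.Ico 2 (k + 1), zetaTerm β (spacing (J N)) i) :=
    div_le_div_of_nonneg_left (zetaTerm_pos _ _ _).le (by linarith)
      (by linarith [sum_Ico_zetaTerm_le_zetaPartial (β := β) (spacing (J N)) hN])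
  linarith

theorem tendsto_zetaTerm_zero_of_tendsto_tvDist {β : ℝ} (hβ : 0 ≤ β)
    {J : (N : ℕ) → Finset (Fin N) → ℝ}
    (h : ∀ i, Tendsto (fun N => sortedEnergy (J N) i / energyScale N) atTop (𝓝 (-1)))
    {k : ℕ} (hk : 1 ≤ k)
    (ht : Tendsto (fun N => tvDist (gibbs β (J N)) (truncGibbs β (J N) k)) atTop (𝓝 0)) :
    Tendsto (fun N => zetaTerm β (spacing (J N)) k) atTop (𝓝 0) := by
  have hb : Tendsto (fun N => boltzmann β (J N) k) atTop (𝓝 0) := by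
    -- The partial sums of ζ could be unbounded in N here, so the denominator 1 + ∑_{2 ≤ i ≤ k} w_i
    -- is bounded by k + 2 instead.
    have h0 := ht.const_mul (k + 2 : ℝ)
    rw [mul_zero] at h0
    refine tendsto_of_tendsto_of_tendsto_of_le_of_le' tendsto_const_nhds h0
      (Eventually.of_forall fun N => (Real.exp_pos _).le) ?_
    filter_upwards [(tendsto_pow_atTop_atTop_of_one_lt
      (one_lt_two : (1:ℕ) < 2)).eventually_gt_atTop k] with N hN
    have h3 := le_tvDist_truncated (energy (J N)) (w := boltzmann β (J N))
      (u := fun i => boltzmann β (J N) i) (boltzmann_pos β (J N))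
      (boltzmann_le_one hβ (J N)) (fun i => boltzmann_pos β (J N) i) hk hN hN
    rw [← gibbs_eq_truncated, ← truncGibbs_eq] at h3
    have hs : ∑ i ∈ Finset.Ico 2 (k + 1), boltzmann β (J N) i ≤ k + 1 := by
      refine (Finset.sum_le_card_nsmul _ _ 1 fun i _ => boltzmann_le_one hβ (J N) i).trans ?_
      rw [nsmul_eq_mul, mul_one]
      exact_mod_cast (by rw [Nat.card_Ico]; omega : (Finset.Ico 2 (k + 1)).card ≤ k + 1)
    have hs0 : 0 ≤ ∑ i ∈ Finset.Ico 2 (k + 1), boltzmann β (J N) i :=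
      Finset.sum_nonneg fun i _ => (boltzmann_pos _ _ _).le
    have hb0 : 0 < boltzmann β (J N) k := Real.exp_pos _
    rw [div_le_iff₀ (by linarith)] at h3
    have ht0 : 0 ≤ tvDist (gibbs β (J N)) (truncGibbs β (J N) k) := by
      by_contra! hneg
      nlinarith
    nlinarith
  simpa using hb.sub (tendsto_boltzmann_sub_zetaTerm hβ h k)

/-! ### Almost sure asymptotics of the lowest energies. -/

theorem HasLaw.measure_Iic_eq {Ω : Type*} [MeasurableSpace Ω] {P : Measure Ω}
    {X : Ω → ℝ} (hX : HasLaw X (gaussianReal 0 1) P) (t : ℝ) :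
    P {ω | X ω ≤ t} = ENNReal.ofReal (stdCdf t) := by
  rw [stdCdf, ofReal_cdf, ← hX.map_eq, Measure.map_apply_of_aemeasurable hX.aemeasurable
    measurableSet_Iic]
  rfl

/-- Chebyshev's bound for the number of i.i.d. standard Gaussian samples below a level. -/
theorem measure_card_le {Ω κ : Type*} [MeasurableSpace Ω] {P : Measure Ω} [IsProbabilityMeasure P]
    [Fintype κ] {X : κ → Ω → ℝ} (hX : ∀ k, HasLaw (X k) (gaussianReal 0 1) P)
    (hI : iIndepFun X P) (t : ℝ) {i : ℕ} (hi : 2 * (i : ℝ) ≤ Fintype.card κ * stdCdf t)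
    (hκ : 0 < Fintype.card κ) :
    P {ω | (Finset.univ.filter fun k => X k ω ≤ t).card ≤ i} ≤
      ENNReal.ofReal (4 / (Fintype.card κ * stdCdf t)) := by
  classical
  set f : ℝ → ℝ := (Set.Iic t).indicator 1 with hf
  have hfm : Measurable f := measurable_one.indicator measurableSet_Iic
  set Y : κ → Ω → ℝ := fun k => f ∘ X k with hY
  have hYm : ∀ k, AEStronglyMeasurable (Y k) P := fun k =>
    (hfm.comp_aemeasurable (hX k).aemeasurable).aestronglyMeasurable
  have hfb : ∀ x, ‖f x‖ ≤ 1 := fun x => by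
    simp only [hf, Set.indicator_apply]; split_ifs <;> simp
  have hYL : ∀ k, MemLp (Y k) 2 P := fun k =>
    MemLp.of_bound (hYm k) 1 (ae_of_all _ fun ω => hfb _)
  have hYE : ∀ k, P[Y k] = stdCdf t := fun k => by
    rw [hY, (hX k).integral_comp hfm.aestronglyMeasurable, hf, integral_indicator_one
      measurableSet_Iic, stdCdf, cdf_eq_real]
  -- Indicators are idempotent, so the variance of the count is at most its mean m, and Chebyshev at
  -- distance m/2 gives 4/m.
  have hYsq : ∀ k, Y k ^ 2 = Y k := fun k => by
    funext ω
    simp only [hY, hf, Pi.pow_apply, Function.comp_apply, Set.indicator_apply]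
    split_ifs <;> simp
  have hvar : variance (∑ k, Y k) P ≤ Fintype.card κ * stdCdf t := by
    rw [IndepFun.variance_sum (fun k _ => hYL k) fun k _ l _ hkl =>
      (hI.indepFun hkl).comp hfm hfm]
    calc ∑ k, variance (Y k) P ≤ ∑ _k : κ, stdCdf t := Finset.sum_le_sum fun k _ => by
          refine (variance_le_expectation_sq (hYm k)).trans ?_
          rw [hYsq, hYE]
      _ = _ := by simp
  have hE : P[∑ k, Y k] = Fintype.card κ * stdCdf t := by
    simp_rw [Finset.sum_apply]
    rw [integral_finsetSum _ fun k _ => (hYL k).integrable one_le_two]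
    simp [hYE]
  set m : ℝ := Fintype.card κ * stdCdf t with hm
  have hm0 : 0 < m := mul_pos (Nat.cast_pos.2 hκ) (stdCdf_pos t)
  have hcheb := meas_ge_le_variance_div_sq (memLp_finsetSum' Finset.univ fun k _ => hYL k)
    (half_pos hm0)
  rw [hE] at hcheb
  refine (measure_mono fun ω hω => ?_).trans (hcheb.trans (ENNReal.ofReal_le_ofReal ?_))
  · have h1 : (∑ k, Y k) ω = (Finset.univ.filter fun k => X k ω ≤ t).card := by
      simp [hY, hf, Set.indicator_apply]
    have h2 : ((Finset.univ.filter fun k => X k ω ≤ t).card : ℝ) ≤ i := Nat.cast_le.2 hω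
    change m / 2 ≤ |(∑ k, Y k) ω - m|
    rw [h1, abs_sub_comm]
    exact le_trans (by linarith) (le_abs_self _)
  · calc variance (∑ k, Y k) P / (m / 2) ^ 2 ≤ m / (m / 2) ^ 2 :=
          div_le_div_of_nonneg_right hvar (sq_nonneg _)
      _ = 4 / m := by field_simp; norm_num

section

variable {Ω : Type*} [MeasurableSpace Ω] {P : Measure Ω} [IsProbabilityMeasure P]
  {J : (N : ℕ) → Finset (Fin N) → Ω → ℝ}

theorem IsDisorder.measure_sortedEnergy_zero_lt_le (hJ : IsDisorder P J) (N : ℕ) (t : ℝ) :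
    P {ω | sortedEnergy (fun α => J N α ω) 0 < t} ≤ ENNReal.ofReal (2 ^ N * stdCdf t) := by
  have hX := (hJ.iid_energy N).1
  calc P {ω | sortedEnergy (fun α => J N α ω) 0 < t}
      ≤ P (⋃ σ : SpinConfig N, {ω | energy (fun α => J N α ω) σ ≤ t}) :=
        measure_mono fun ω hω => Set.mem_iUnion.2 ⟨_, (show sortedEnergy _ 0 < t from hω).le⟩
    _ ≤ ∑ σ : SpinConfig N, P {ω | energy (fun α => J N α ω) σ ≤ t} :=
        measure_iUnion_fintype_le _ _
    _ = ENNReal.ofReal (2 ^ N * stdCdf t) := by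
        simp_rw [HasLaw.measure_Iic_eq (hX _)]
        rw [Finset.sum_const, Finset.card_univ, card_spinConfig, nsmul_eq_mul,
          ENNReal.ofReal_mul (by positivity)]
        congr 1
        rw [ENNReal.ofReal_pow zero_le_two]
        simp

theorem card_energy_le_of_lt_sortedEnergy {N : ℕ} (J : Finset (Fin N) → ℝ) {t : ℝ} {i : ℕ}
    (ht : t < sortedEnergy J i) : (Finset.univ.filter fun σ => energy J σ ≤ t).card ≤ i := by
  calc (Finset.univ.filter fun σ => energy J σ ≤ t).card ≤ (Finset.range i).card := by
        refine Finset.card_le_card_of_injOn (fun σ => ((ranked (energy J)).symm σ : ℕ)) ?_ ?_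
        · intro σ hσ
          have h1 : energy J σ ≤ t := by simpa using hσ
          rw [Finset.coe_range, Set.mem_Iio]
          by_contra! h
          have h2 := sortedEnergy_mono J h
          rw [sortedEnergy_val, Equiv.apply_symm_apply] at h2
          linarith
        · intro σ _ τ _ h
          exact (ranked (energy J)).symm.injective (Fin.ext h)
    _ = i := Finset.card_range i

theorem IsDisorder.measure_lt_sortedEnergy_le (hJ : IsDisorder P J) (N : ℕ) (t : ℝ) {i : ℕ}
    (hi : 2 * (i : ℝ) ≤ 2 ^ N * stdCdf t) :
    P {ω | t < sortedEnergy (fun α => J N α ω) i} ≤ ENNReal.ofReal (4 / (2 ^ N * stdCdf t)) := by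
  have hc : (Fintype.card (SpinConfig N) : ℝ) = 2 ^ N := by rw [card_spinConfig]; simp
  have h := measure_card_le (hJ.iid_energy N).1 (hJ.iid_energy N).2 t (i := i) (by rwa [hc])
    Fintype.card_pos
  rw [hc] at h
  exact (measure_mono fun ω hω => card_energy_le_of_lt_sortedEnergy _ hω).trans h

-- Borel-Cantelli without independence, for bounds that hold only from some index on.
omit [IsProbabilityMeasure P] in
theorem ae_eventually_not_of_measure_le {p : ℕ → Ω → Prop} {f : ℕ → ℝ} (hf : Summable f)
    (h : ∀ᶠ n in atTop, P {ω | p n ω} ≤ ENNReal.ofReal (f n)) :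
    ∀ᵐ ω ∂P, ∀ᶠ n in atTop, ¬ p n ω := by
  obtain ⟨n₀, hn₀⟩ := eventually_atTop.1 h
  have hs : ∑' n, P {ω | n₀ ≤ n ∧ p n ω} ≠ ⊤ := by
    refine ne_top_of_le_ne_top (hf.tsum_ofReal_ne_top) (ENNReal.tsum_le_tsum fun n => ?_)
    by_cases hn : n₀ ≤ n
    · simpa [hn] using hn₀ n hn
    · simp [hn]
  filter_upwards [ae_eventually_notMem hs] with ω hω
  filter_upwards [hω, eventually_ge_atTop n₀] with n h1 h2 h3
  exact h1 ⟨h2, h3⟩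

theorem exp_neg_sq_energyScale (θ : ℝ) (N : ℕ) :
    Real.exp (-(θ * energyScale N) ^ 2 / 2) = ((2 : ℝ) ^ (-θ ^ 2)) ^ N := by
  have h : energyScale N ^ 2 = 2 * (N * Real.log 2) := by
    rw [energyScale, Real.sq_sqrt, Real.log_pow]
    exact mul_nonneg zero_le_two (Real.log_nonneg (one_le_pow₀ one_le_two))
  rw [mul_pow, h, Real.rpow_def_of_pos two_pos, ← Real.exp_nat_mul]
  congr 1
  ring

/-- First moment: the expected number of energies below -θL is at most 2^{(1-θ²)N}, summable for θ >
1. -/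
theorem IsDisorder.ae_eventually_le_sortedEnergy_zero (hJ : IsDisorder P J) {θ : ℝ} (hθ : 1 < θ) :
    ∀ᵐ ω ∂P, ∀ᶠ N in atTop, -(θ * energyScale N) ≤ sortedEnergy (fun α => J N α ω) 0 := by
  have hr : (2 : ℝ) ^ (1 - θ ^ 2) < 1 := Real.rpow_lt_one_of_one_lt_of_neg one_lt_two (by nlinarith)
  have h := ae_eventually_not_of_measure_le (P := P)
    (p := fun N ω => sortedEnergy (fun α => J N α ω) 0 < -(θ * energyScale N))
    (summable_geometric_of_lt_one (by positivity) hr) (by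
      filter_upwards [tendsto_energyScale.eventually_ge_atTop 1] with N hN
      refine (hJ.measure_sortedEnergy_zero_lt_le N _).trans (ENNReal.ofReal_le_ofReal ?_)
      have h1 := stdCdf_neg_le (s := θ * energyScale N) (by nlinarith)
      rw [exp_neg_sq_energyScale] at h1
      calc 2 ^ N * stdCdf (-(θ * energyScale N)) ≤ 2 ^ N * ((2 : ℝ) ^ (-θ ^ 2)) ^ N := by gcongr
        _ = ((2 : ℝ) ^ (1 - θ ^ 2)) ^ N := by
          rw [← mul_pow, sub_eq_add_neg, Real.rpow_add two_pos, Real.rpow_one])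
  simpa using h

/-- Second moment: the expected number m of energies below -θL is at least 2^{(1-θ²)N} / (3(1+2N)),
so the failure probability 4/m is summable for θ < 1. -/
theorem IsDisorder.ae_eventually_sortedEnergy_le (hJ : IsDisorder P J) {θ : ℝ} (hθ0 : 0 < θ)
    (hθ : θ < 1) (i : ℕ) :
    ∀ᵐ ω ∂P, ∀ᶠ N in atTop, sortedEnergy (fun α => J N α ω) i ≤ -(θ * energyScale N) := by
  set r : ℝ := (2 : ℝ) ^ (θ ^ 2 - 1) with hrdef
  have hr0 : 0 < r := by positivity
  have hr : r < 1 := Real.rpow_lt_one_of_one_lt_of_neg one_lt_two (by nlinarith)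
  have hsum : Summable fun N : ℕ => 12 * ((1 + 2 * N) * r ^ N) := by
    have h1 := summable_geometric_of_lt_one hr0.le hr
    have h2 := summable_pow_mul_geometric_of_norm_lt_one 1
      (show ‖r‖ < 1 by rwa [Real.norm_of_nonneg hr0.le])
    refine ((h1.add (h2.mul_left 2)).mul_left 12).congr fun N => ?_
    ring
  have key : ∀ᶠ N : ℕ in atTop,
      1 ≤ 3 * ((1 + 2 * N) * r ^ N) * (2 ^ N * stdCdf (-(θ * energyScale N))) := by
    filter_upwards [tendsto_energyScale.eventually_ge_atTop (1 / θ)] with N hN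
    have h1 := le_stdCdf_neg (s := θ * energyScale N) (by
      rwa [div_le_iff₀ hθ0, mul_comm] at hN)
    rw [exp_neg_sq_energyScale] at h1
    have h2 : (θ * energyScale N) ^ 2 ≤ 2 * N := by
      have h : energyScale N ^ 2 = 2 * (N * Real.log 2) := by
        rw [energyScale, Real.sq_sqrt, Real.log_pow]
        exact mul_nonneg zero_le_two (Real.log_nonneg (one_le_pow₀ one_le_two))
      have hl : Real.log 2 ≤ 1 := by linarith [Real.log_two_lt_d9]
      have hN0 : (0 : ℝ) ≤ N := Nat.cast_nonneg N
      rw [mul_pow, h]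
      have h3 : N * Real.log 2 ≤ N := mul_le_of_le_one_right hN0 hl
      have h4 : 0 ≤ N * Real.log 2 := mul_nonneg hN0 (Real.log_nonneg one_le_two)
      have h5 : θ ^ 2 ≤ 1 := by nlinarith
      nlinarith [mul_le_mul_of_nonneg_right h5 h4]
    have h3 : r ^ N * 2 ^ N * ((2 : ℝ) ^ (-θ ^ 2)) ^ N = 1 := by
      rw [← mul_pow, ← mul_pow, hrdef]
      have : (2 : ℝ) ^ (θ ^ 2 - 1) * 2 * 2 ^ (-θ ^ 2) = 1 := by
        conv_lhs => rw [← Real.rpow_one 2, ← Real.rpow_mul zero_le_two, one_mul,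
          ← Real.rpow_mul zero_le_two, one_mul, ← Real.rpow_add two_pos, ← Real.rpow_add two_pos]
        ring_nf
        simp
      rw [this, one_pow]
    calc (1 : ℝ) = r ^ N * 2 ^ N * ((2 : ℝ) ^ (-θ ^ 2)) ^ N := h3.symm
      _ ≤ r ^ N * 2 ^ N * (3 * (1 + 2 * N) * stdCdf (-(θ * energyScale N))) := by
        refine mul_le_mul_of_nonneg_left (h1.trans ?_) (by positivity)
        have := stdCdf_pos (-(θ * energyScale N))
        gcongr
      _ = _ := by ring
  have hpos : ∀ N : ℕ, 0 < 3 * ((1 + 2 * (N : ℝ)) * r ^ N) := fun N => by positivity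
  have hzero : Tendsto (fun N : ℕ => 2 * (i : ℝ) * (3 * ((1 + 2 * N) * r ^ N))) atTop (𝓝 0) := by
    have := (hsum.tendsto_atTop_zero.const_mul (2 * (i : ℝ) / 4))
    rw [mul_zero] at this
    refine this.congr fun N => ?_
    ring
  have h := ae_eventually_not_of_measure_le (P := P)
    (p := fun N ω => -(θ * energyScale N) < sortedEnergy (fun α => J N α ω) i)
    hsum (by
      filter_upwards [key, hzero.eventually_lt_const one_pos] with N h1 h2
      have hm : 0 < 2 ^ N * stdCdf (-(θ * energyScale N)) :=
        mul_pos (by positivity) (stdCdf_pos _)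
      refine (hJ.measure_lt_sortedEnergy_le N _ ?_).trans (ENNReal.ofReal_le_ofReal ?_)
      · have := hpos N
        by_contra! hneg
        nlinarith
      · rw [div_le_iff₀ hm]
        nlinarith)
  simpa using h

/-- The lowest energies are asymptotic to the edge `-√(2 log 2^N)`, almost surely. -/
theorem IsDisorder.ae_tendsto_sortedEnergy_div (hJ : IsDisorder P J) :
    ∀ᵐ ω ∂P, ∀ i, Tendsto (fun N => sortedEnergy (fun α => J N α ω) i / energyScale N)
      atTop (𝓝 (-1)) := by
  have h1 : ∀ᵐ ω ∂P, ∀ m : ℕ, ∀ᶠ N in atTop,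
      -((1 + 1 / ((m : ℝ) + 1)) * energyScale N) ≤ sortedEnergy (fun α => J N α ω) 0 :=
    ae_all_iff.2 fun m => hJ.ae_eventually_le_sortedEnergy_zero (by
      have : (0 : ℝ) < 1 / ((m : ℝ) + 1) := by positivity
      linarith)
  have h2 : ∀ᵐ ω ∂P, ∀ i m : ℕ, ∀ᶠ N in atTop,
      sortedEnergy (fun α => J N α ω) i ≤ -((1 - 1 / ((m : ℝ) + 2)) * energyScale N) :=
    ae_all_iff.2 fun i => ae_all_iff.2 fun m => hJ.ae_eventually_sortedEnergy_le (by
      have : 1 / ((m : ℝ) + 2) < 1 := by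
        rw [div_lt_one (by positivity)]
        linarith [(Nat.cast_nonneg m : (0 : ℝ) ≤ m)]
      linarith) (by
      have : (0 : ℝ) < 1 / ((m : ℝ) + 2) := by positivity
      linarith) i
  filter_upwards [h1, h2] with ω h1 h2 i
  have hL := tendsto_energyScale.eventually_gt_atTop 0
  refine tendsto_order.2 ⟨fun b hb => ?_, fun b hb => ?_⟩
  · obtain ⟨m, hm⟩ := exists_nat_one_div_lt (show 0 < -1 - b by linarith)
    filter_upwards [hL, h1 m] with N h0 h
    rw [lt_div_iff₀ h0]
    have := sortedEnergy_mono (fun α => J N α ω) (Nat.zero_le i)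
    nlinarith
  · obtain ⟨m, hm⟩ := exists_nat_one_div_lt (show 0 < b + 1 by linarith)
    have hm' : 1 / ((m : ℝ) + 2) < b + 1 :=
      (one_div_le_one_div_of_le (by positivity) (by linarith)).trans_lt hm
    filter_upwards [hL, h2 i m] with N h0 h
    rw [div_lt_iff₀ h0]
    nlinarith

/-! ### The distance does not tend to zero. -/

theorem IsDisorder.ae_not_tendsto_zetaTerm_zero (hJ : IsDisorder P J) {β : ℝ} (hβ : 0 ≤ β)
    (k : ℕ) :
    ∀ᵐ ω ∂P, ¬ Tendsto (fun N => zetaTerm β (spacing fun α => J N α ω) k) atTop (𝓝 0) := by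
  set E := {ω | Tendsto (fun N => zetaTerm β (spacing fun α => J N α ω) k) atTop (𝓝 0)} with hE
  let U : ℕ → ℕ → Ω → ℝ := fun N i ω => stdCdf (sortedEnergy (fun α => J N α ω) i)
  -- For each N, U_1 < s/2^N has probability at most s and U_{k+1} > 1/(s 2^N) at most 4s.
  have hP : ∀ s : ℝ, 0 < s → s < 1 → 2 * k * s ≤ 1 → P E ≤ ENNReal.ofReal (5 * s) := by
    intro s hs hs1 hks
    let A : ℕ → Set Ω := fun N => {ω | U N 0 ω < s / 2 ^ N} ∪ {ω | 1 / (s * 2 ^ N) < U N k ω}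
    have hpow : Tendsto (fun N : ℕ => (2 : ℝ) ^ N) atTop atTop :=
      tendsto_pow_atTop_atTop_of_one_lt one_lt_two
    have hA : ∀ᶠ N in atTop, P (A N) ≤ ENNReal.ofReal (5 * s) := by
      filter_upwards [hpow.eventually_gt_atTop (1 / s)] with N hN
      have h2 : (0 : ℝ) < 2 ^ N := by positivity
      have hmem1 : s / 2 ^ N ∈ Set.Ioo (0 : ℝ) 1 :=
        ⟨by positivity, by rw [div_lt_one h2]; exact hs1.trans_le (one_le_pow₀ one_le_two)⟩
      have hmem2 : 1 / (s * 2 ^ N) ∈ Set.Ioo (0 : ℝ) 1 := by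
        refine ⟨by positivity, ?_⟩
        rw [div_lt_iff₀ hs] at hN
        rw [div_lt_one (by positivity)]
        linarith
      rw [← range_stdCdf] at hmem1 hmem2
      obtain ⟨t, ht⟩ := hmem1
      obtain ⟨t', ht'⟩ := hmem2
      have e1 : 2 ^ N * stdCdf t = s := by rw [ht]; field_simp
      have e2 : 2 ^ N * stdCdf t' = 1 / s := by rw [ht']; field_simp
      calc P (A N) ≤ P {ω | U N 0 ω < s / 2 ^ N} + P {ω | 1 / (s * 2 ^ N) < U N k ω} :=
            measure_union_le _ _
        _ ≤ ENNReal.ofReal s + ENNReal.ofReal (4 * s) := by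
            rw [← ht, ← ht']
            refine add_le_add ?_ ?_
            · have := hJ.measure_sortedEnergy_zero_lt_le N t
              rw [e1] at this
              exact (measure_mono fun ω hω => strictMono_stdCdf.lt_iff_lt.1 hω).trans this
            · have := hJ.measure_lt_sortedEnergy_le N t' (i := k) (by
                rw [e2, le_div_iff₀ hs]; exact hks)
              rw [e2, div_div_eq_mul_div, div_one] at this
              exact (measure_mono fun ω hω => strictMono_stdCdf.lt_iff_lt.1 hω).trans this
        _ = ENNReal.ofReal (5 * s) := by
            rw [← ENNReal.ofReal_add hs.le (by linarith)]
            ring_nf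
    -- Off A_N one has U_{k+1}/U_1 ≤ s⁻², which keeps the term away from 0. So E lies in the liminf
    -- of the A_N, and bounding its measure requires nothing about the joint law in N.
    have hsub : E ⊆ ⋃ n, ⋂ m ≥ n, A m := by
      intro ω hω
      have hlt := Tendsto.eventually_lt_const
        (Real.exp_pos (-(β / betaC * (-(2 * Real.log s))))) hω
      obtain ⟨n, hn⟩ := eventually_atTop.1 (hlt.and
        ((tendsto_pow_atTop_atTop_of_one_lt (one_lt_two : (1 : ℕ) < 2)).eventually_gt_atTop k))
      refine Set.mem_iUnion.2 ⟨n, Set.mem_iInter₂.2 fun N hN => ?_⟩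
      obtain ⟨h1, h2⟩ := hn N hN
      by_contra hA
      simp only [A, Set.mem_union, Set.mem_ofPred_eq, not_or, not_lt] at hA
      rw [zetaTerm_spacing β _ h2, Real.exp_lt_exp, neg_lt_neg_iff] at h1
      have l1 := Real.log_le_log (by positivity) hA.1
      have l2 := Real.log_le_log (stdCdf_pos _) hA.2
      rw [Real.log_div hs.ne' (by positivity)] at l1
      rw [one_div, Real.log_inv, Real.log_mul hs.ne' (by positivity)] at l2
      have := lt_of_mul_lt_mul_left h1 (div_nonneg hβ betaC_pos.le)
      simp only [U] at l1 l2
      linarith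
    have hmono : Monotone fun n => ⋂ m ≥ n, A m := fun n n' hn =>
      Set.iInter₂_mono' fun m hm => ⟨m, hn.trans hm, le_rfl⟩
    obtain ⟨n₀, hn₀⟩ := eventually_atTop.1 hA
    refine (measure_mono hsub).trans ?_
    rw [hmono.measure_iUnion]
    refine iSup_le fun n => le_trans (measure_mono ?_) (hn₀ (max n n₀) (le_max_right _ _))
    exact Set.iInter₂_subset (max n n₀) (le_max_left _ _)
  have h0 : P E ≤ 0 := by
    have hlim : Tendsto (fun s : ℝ => ENNReal.ofReal (5 * s)) (𝓝[>] 0) (𝓝 0) := by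
      have : Tendsto (fun s : ℝ => ENNReal.ofReal (5 * s)) (𝓝 0) (𝓝 (ENNReal.ofReal (5 * 0))) :=
        (ENNReal.continuous_ofReal.comp (continuous_const.mul continuous_id)).tendsto 0
      rw [mul_zero, ENNReal.ofReal_zero] at this
      exact this.mono_left nhdsWithin_le_nhds
    refine ge_of_tendsto hlim ?_
    have hc : Tendsto (fun s : ℝ => 2 * k * s) (𝓝[>] 0) (𝓝 0) := by
      have : Tendsto (fun s : ℝ => 2 * k * s) (𝓝 0) (𝓝 (2 * k * 0)) :=
        (continuous_const.mul continuous_id).tendsto 0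
      rw [mul_zero] at this
      exact this.mono_left nhdsWithin_le_nhds
    filter_upwards [self_mem_nhdsWithin, hc.eventually_le_const one_pos,
      (eventually_lt_nhds (zero_lt_one' ℝ)).filter_mono nhdsWithin_le_nhds] with s h1 h2 h3
    exact hP s h1 h3 h2
  rw [ae_iff]
  simpa using h0

end

/-! ### Almost sure convergence of ζ. -/

theorem lintegral_exp_neg_mul_expMeasure {c : ℝ} (hc : 0 ≤ c) :
    ∫⁻ x, ENNReal.ofReal (Real.exp (-(c * x))) ∂expMeasure 1 = ENNReal.ofReal (1 + c)⁻¹ := by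
  have hc1 : 0 < 1 + c := by linarith
  have hm : ∀ r, Measurable (exponentialPDF r) := fun r =>
    (measurable_exponentialPDFReal r).ennreal_ofReal
  have h : expMeasure 1 = volume.withDensity (exponentialPDF 1) := rfl
  rw [h, lintegral_withDensity_eq_lintegral_mul _ (hm 1) (by fun_prop)]
  have h2 : ∀ x : ℝ, (exponentialPDF 1 * fun x => ENNReal.ofReal (Real.exp (-(c * x)))) x =
      ENNReal.ofReal (1 + c)⁻¹ * exponentialPDF (1 + c) x := fun x => by
    rw [Pi.mul_apply, exponentialPDF_eq, exponentialPDF_eq]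
    split_ifs
    · rw [← ENNReal.ofReal_mul (by positivity), ← ENNReal.ofReal_mul (by positivity),
        ← mul_assoc, inv_mul_cancel₀ hc1.ne', one_mul, one_mul, one_mul, ← Real.exp_add]
      ring_nf
    · simp
  simp_rw [h2]
  rw [lintegral_const_mul _ (hm _), lintegral_exponentialPDF_eq_one hc1, mul_one]

theorem summable_prod_inv_one_add_div {a : ℝ} (ha : 1 < a) :
    Summable fun j : ℕ => ∏ l ∈ Finset.range j, (1 + a / ((l : ℝ) + 1))⁻¹ := by
  set c : ℕ → ℝ := fun j => ∏ l ∈ Finset.range j, (1 + a / ((l : ℝ) + 1))⁻¹ with hc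
  have hpos : ∀ j, 0 < c j := fun j => Finset.prod_pos fun l _ => by positivity
  -- The right side telescopes, so (a - 1) times the partial sums stays below 1; no asymptotics of
  -- the product are needed.
  have hrec : ∀ j : ℕ, (a - 1) * c (j + 1) = ((j : ℝ) + 1) * c j - ((j : ℝ) + 2) * c (j + 1) := by
    intro j
    have : c (j + 1) = c j * (1 + a / ((j : ℝ) + 1))⁻¹ := Finset.prod_range_succ _ _
    rw [this]
    have h1 : (j : ℝ) + 1 ≠ 0 := by positivity
    have h2 : (j : ℝ) + 1 + a ≠ 0 := by positivity
    field_simp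
    ring
  have hsum : ∀ n : ℕ, ∑ j ∈ Finset.range n, (a - 1) * c (j + 1) = 1 - ((n : ℝ) + 1) * c n := by
    intro n
    induction n with
    | zero => simp [hc]
    | succ n ih =>
      rw [Finset.sum_range_succ, ih, hrec]
      push_cast
      ring
  have h1 : Summable fun j => (a - 1) * c (j + 1) :=
    summable_of_sum_range_le (c := 1) (fun j => mul_nonneg (by linarith) (hpos _).le) fun n => by
      rw [hsum n]
      have := mul_pos (show (0 : ℝ) < n + 1 by positivity) (hpos n)
      linarith
  exact (summable_nat_add_iff 1).1 ((summable_mul_left_iff (by linarith)).1 h1)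

/-- By Tonelli and independence the series has finite expectation, the sum of the products of
Laplace transforms. -/
theorem ae_summable_exp_neg_sum {Ω : Type*} [MeasurableSpace Ω] {P : Measure Ω}
    {Y : ℕ → Ω → ℝ} (hY : ∀ l, HasLaw (Y l) (expMeasure 1) P) (hm : ∀ l, Measurable (Y l))
    (hI : iIndepFun Y P) {a : ℝ} (ha : 1 < a) :
    ∀ᵐ ω ∂P, Summable fun j : ℕ =>
      Real.exp (-(a * ∑ l ∈ Finset.range j, Y l ω / ((l : ℝ) + 1))) := by
  let f : ℕ → Ω → ENNReal := fun l ω => ENNReal.ofReal (Real.exp (-(a / ((l : ℝ) + 1) * Y l ω)))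
  have hf : ∀ l, Measurable (f l) := fun l => by have := hm l; fun_prop
  have hfI : iIndepFun f P := hI.comp
    (fun l x => ENNReal.ofReal (Real.exp (-(a / ((l : ℝ) + 1) * x)))) fun l => by fun_prop
  have hprod : ∀ j ω, ENNReal.ofReal
      (Real.exp (-(a * ∑ l ∈ Finset.range j, Y l ω / ((l : ℝ) + 1)))) =
      ∏ l ∈ Finset.range j, f l ω := fun j ω => by
    rw [← ENNReal.ofReal_prod_of_nonneg fun l _ => (Real.exp_pos _).le, ← Real.exp_sum,
      Finset.sum_neg_distrib, Finset.mul_sum]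
    congr 3
    refine Finset.sum_congr rfl fun l _ => ?_
    ring
  have hE : ∀ j, ∫⁻ ω, ∏ l ∈ Finset.range j, f l ω ∂P =
      ENNReal.ofReal (∏ l ∈ Finset.range j, (1 + a / ((l : ℝ) + 1))⁻¹) := fun j => by
    rw [lintegral_prod_eq_prod_lintegral_of_indepFun _ f hfI hf,
      ENNReal.ofReal_prod_of_nonneg fun l _ => by positivity]
    refine Finset.prod_congr rfl fun l _ => ?_
    rw [← lintegral_exp_neg_mul_expMeasure (by positivity), ← (hY l).lintegral_comp (by fun_prop)]
  have hfin : ∫⁻ ω, ∑' j, ∏ l ∈ Finset.range j, f l ω ∂P ≠ ⊤ := by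
    rw [lintegral_tsum fun j => (Finset.measurable_fun_prod _ fun l _ => hf l).aemeasurable]
    simp_rw [hE]
    exact (summable_prod_inv_one_add_div ha).tsum_ofReal_ne_top
  filter_upwards [ae_lt_top (Measurable.tsum fun j =>
    Finset.measurable_fun_prod _ fun l _ => hf l) hfin] with ω hω
  refine (ENNReal.summable_toReal hω.ne).congr fun j => ?_
  rw [← hprod, ENNReal.toReal_ofReal (Real.exp_pos _).le]

theorem weightedSum_eq_sum_range (W : ℕ → ℝ) (j : ℕ) :
    weightedSum W j = ∑ l ∈ Finset.range j, W (l + 1) / ((l : ℝ) + 1) := by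
  unfold weightedSum
  induction j with
  | zero => simp
  | succ j ih =>
    rw [Finset.sum_Icc_succ_top (by omega), ih, Finset.sum_range_succ]
    push_cast
    rfl

theorem ae_summable_zetaTerm {Ω : Type*} [MeasurableSpace Ω] {P : Measure Ω} {W : ℕ → Ω → ℝ}
    (hW : ∀ l, 1 ≤ l → HasLaw (W l) (expMeasure 1) P) (hI : iIndepFun (fun l : ℕ => W (l + 1)) P)
    {β : ℝ} (hβ : betaC < β) : ∀ᵐ ω ∂P, Summable (zetaTerm β fun l => W l ω) := by
  have hW' : ∀ l, HasLaw (W (l + 1)) (expMeasure 1) P := fun l => hW _ (by omega)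
  -- `HasLaw` gives only a.e. measurability, hence the measurable versions.
  let Y : ℕ → Ω → ℝ := fun l => (hW' l).aemeasurable.mk (W (l + 1))
  have hae : ∀ l, W (l + 1) =ᵐ[P] Y l := fun l => (hW' l).aemeasurable.ae_eq_mk
  have h := ae_summable_exp_neg_sum (Y := Y) (fun l => (hW' l).congr (hae l).symm)
    (fun l => (hW' l).aemeasurable.measurable_mk) (hI.congr hae)
    ((one_lt_div betaC_pos).2 hβ)
  filter_upwards [h, ae_all_iff.2 hae] with ω h1 h2
  refine h1.congr fun j => ?_
  rw [zetaTerm, weightedSum_eq_sum_range, neg_mul]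
  simp_rw [h2]

theorem ae_pos_of_hasLaw_expMeasure {Ω : Type*} [MeasurableSpace Ω] {P : Measure Ω} {X : Ω → ℝ}
    (hX : HasLaw X (expMeasure 1) P) : ∀ᵐ ω ∂P, 0 < X ω := by
  have h : ∀ᵐ x ∂expMeasure 1, 0 < x := by
    rw [ae_iff]
    have h1 : {x : ℝ | ¬ 0 < x} = Set.Iic 0 := by ext; simp
    have : IsProbabilityMeasure (expMeasure 1) := isProbabilityMeasure_expMeasure one_pos
    rw [h1, ← ofReal_cdf, cdf_expMeasure_eq one_pos]
    simp
  rw [← hX.map_eq] at h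
  exact ae_of_ae_map hX.aemeasurable h

/-! ### Assembly of the probabilistic bounds. -/

section

variable {Ω : Type*} [MeasurableSpace Ω] {P : Measure Ω} [IsProbabilityMeasure P]
  {J : (N : ℕ) → Finset (Fin N) → Ω → ℝ}

theorem weightedSum_congr {W W' : ℕ → ℝ} {j : ℕ} (h : ∀ l, 1 ≤ l → l ≤ j → W l = W' l) :
    weightedSum W j = weightedSum W' j :=
  Finset.sum_congr rfl fun l hl => by
    rw [h l (Finset.mem_Icc.1 hl).1 (Finset.mem_Icc.1 hl).2]

theorem zetaPartial_le_zeta {β : ℝ} {W : ℕ → ℝ}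
    (hs : Summable fun j : ℕ => zetaTerm β W (j + 2)) (n : ℕ) : zetaPartial β W n ≤ zeta β W := by
  have h : zetaPartial β W n = ∑ j ∈ Finset.range (n + 1 - 2), zetaTerm β W (j + 2) := by
    rw [zetaPartial, ← Finset.Ico_add_one_right_eq_Icc, Finset.sum_Ico_eq_sum_range]
    exact Finset.sum_congr rfl fun j _ => by rw [add_comm]
  rw [h]
  exact hs.sum_le_tsum _ fun j _ => (zetaTerm_pos _ _ _).le

theorem zetaTerm_le_one {β : ℝ} (hβ : 0 ≤ β) {W : ℕ → ℝ} (hW : ∀ l, 1 ≤ l → 0 ≤ W l) (j : ℕ) :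
    zetaTerm β W j ≤ 1 := by
  rw [zetaTerm, neg_mul, Real.exp_le_one_iff, neg_nonpos]
  exact mul_nonneg (div_nonneg hβ betaC_pos.le) (Finset.sum_nonneg fun l hl =>
    div_nonneg (hW l (Finset.mem_Icc.1 hl).1) (Nat.cast_nonneg l))

/-- The upper bound `b` is essential: it keeps the set of eventual lower bounds bounded, so that the
real `liminf` is not a default value. -/
theorem le_liminf_of_eventually_sub_le {f : ℕ → ℝ} {a b : ℝ} (hb : ∀ᶠ n in atTop, f n ≤ b)
    (h : ∀ ε > 0, ∀ᶠ n in atTop, a - ε ≤ f n) : a ≤ liminf f atTop := by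
  refine le_of_forall_sub_le fun ε hε => le_liminf_of_le ?_ (h ε hε)
  exact IsBoundedUnder.isCoboundedUnder_ge ⟨b, by simpa using hb⟩

theorem IsDisorder.ae_arbitrary_law (hJ : IsDisorder P J) {β : ℝ} (hβ : 0 ≤ β) :
    ∀ᵐ ω ∂P, ∀ k₀ : ℕ, 1 ≤ k₀ →
      (∀ ε : ℝ, 0 < ε → ∀ᶠ N : ℕ in atTop,
        Real.exp (-(β / betaC) * weightedSum (spacing (fun α => J N α ω)) k₀) /
            (1 + zetaPartial β (spacing (fun α => J N α ω)) (2 ^ N)) - ε ≤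
          tvDist (gibbs β (fun α => J N α ω)) (truncGibbs β (fun α => J N α ω) k₀)) ∧
      ¬ Tendsto (fun N : ℕ => tvDist (gibbs β (fun α => J N α ω))
            (truncGibbs β (fun α => J N α ω) k₀)) atTop (𝓝 0) := by
  filter_upwards [hJ.ae_tendsto_sortedEnergy_div,
    ae_all_iff.2 fun k => hJ.ae_not_tendsto_zetaTerm_zero hβ k] with ω h1 h2 k hk
  refine ⟨fun ε hε => ?_, fun ht => h2 k ?_⟩
  · simp_rw [truncGibbs_eq]
    exact eventually_sub_le_tvDist_gibbs hβ h1 hk _ (fun N i => boltzmann_pos _ _ _) hε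
  · exact tendsto_zetaTerm_zero_of_tendsto_tvDist hβ h1 hk ht

theorem IsCoupling.ae_liminf {W : ℕ → Ω → ℝ} (h : IsCoupling P J W) {β : ℝ} (hβ : betaC < β) :
    ∀ᵐ ω ∂P, Summable (fun j : ℕ => zetaTerm β (fun l => W l ω) (j + 2)) ∧
      ∀ k₀ : ℕ, 1 ≤ k₀ →
        0 < Real.exp (-(β / betaC) * weightedSum (fun l => W l ω) k₀) /
            (1 + zeta β (fun l => W l ω)) ∧
        Real.exp (-(β / betaC) * weightedSum (fun l => W l ω) k₀) /
            (1 + zeta β (fun l => W l ω)) ≤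
          liminf (fun N : ℕ => tvDist (gibbs β (fun α => J N α ω))
            (truncGibbs β (fun α => J N α ω) k₀)) atTop ∧
        Real.exp (-(β / betaC) * weightedSum (fun l => W l ω) k₀) /
            (1 + zeta β (fun l => W l ω)) ≤
          liminf (fun N : ℕ => tvDist (gibbs β (fun α => J N α ω))
            (truncExp β (fun α => J N α ω) (fun l => W l ω) k₀)) atTop ∧
        ∀ k : ℕ → ℕ, Tendsto k atTop atTop →
          Real.exp (-(β / betaC) * weightedSum (fun l => W l ω) k₀) /
              (1 + zeta β (fun l => W l ω)) ≤
            liminf (fun N : ℕ => tvDist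
              (truncExp β (fun α => J N α ω) (fun l => W l ω) k₀)
              (truncExp β (fun α => J N α ω) (fun l => W l ω) (k N))) atTop := by
  have hβ0 : 0 ≤ β := betaC_pos.le.trans hβ.le
  filter_upwards [h.disorder.ae_tendsto_sortedEnergy_div, h.link,
    ae_summable_zetaTerm h.exponential h.indep hβ,
    ae_all_iff.2 fun l : ℕ => ae_pos_of_hasLaw_expMeasure (h.exponential (l + 1) (by omega))]
    with ω h1 hlink hs hpos
  have hs2 := (summable_nat_add_iff 2).2 hs
  refine ⟨hs2, fun k hk => ?_⟩
  set w : ℕ → ℝ := fun l => W l ω with hw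
  have hw0 : ∀ l, 1 ≤ l → 0 ≤ w l := fun l hl => by
    obtain ⟨l, rfl⟩ := Nat.exists_eq_add_of_le' hl
    exact (hpos l).le
  change 0 < zetaTerm β w k / (1 + zeta β w) ∧ zetaTerm β w k / (1 + zeta β w) ≤ _ ∧
    zetaTerm β w k / (1 + zeta β w) ≤ _ ∧ ∀ k' : ℕ → ℕ, Tendsto k' atTop atTop →
    zetaTerm β w k / (1 + zeta β w) ≤ _
  have hz0 : 0 ≤ zeta β w := tsum_nonneg fun j => (zetaTerm_pos _ _ _).le
  have hpow := (tendsto_pow_atTop_atTop_of_one_lt (one_lt_two : (1 : ℕ) < 2)).eventually_gt_atTop k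
  -- The weights of the truncated measure play no role, only its support; one bound therefore serves
  -- both μ^(1) and μ^(2).
  have key : ∀ u : (N : ℕ) → Fin (2 ^ N) → ℝ, (∀ N i, 0 < u N i) →
      zetaTerm β w k / (1 + zeta β w) ≤ liminf (fun N : ℕ => tvDist (gibbs β (fun α => J N α ω))
        (truncated (energy fun α => J N α ω) (u N) k)) atTop := by
    intro u hu
    refine le_liminf_of_eventually_sub_le (b := 2) (Eventually.of_forall fun N => ?_)
      fun ε hε => ?_
    · rw [gibbs_eq_truncated]
      exact tvDist_truncated_le_two _ (fun i => boltzmann_pos _ _ _) (hu N) Nat.one_le_two_pow hk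
    · filter_upwards [eventually_sub_le_tvDist_gibbs hβ0 h1 hk u hu hε, hpow] with N hN hkN
      refine le_trans ?_ hN
      have e : ∀ j ≤ 2 ^ N, zetaTerm β (spacing fun α => J N α ω) j = zetaTerm β w j :=
        fun j hj => by
          rw [zetaTerm, zetaTerm, weightedSum_congr fun l hl hl' => hlink N l hl (hl'.trans hj)]
      have e2 : zetaPartial β (spacing fun α => J N α ω) (2 ^ N) = zetaPartial β w (2 ^ N) :=
        Finset.sum_congr rfl fun j hj => e j (Finset.mem_Icc.1 hj).2
      have h0 : 0 ≤ zetaPartial β w (2 ^ N) := Finset.sum_nonneg fun j _ => (zetaTerm_pos _ _ _).le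
      rw [e k hkN.le, e2]
      exact sub_le_sub_right (div_le_div_of_nonneg_left (zetaTerm_pos _ _ _).le (by linarith)
        (by linarith [zetaPartial_le_zeta hs2 (2 ^ N)])) ε
  refine ⟨div_pos (zetaTerm_pos _ _ _) (by linarith), ?_, ?_, fun k' hk' => ?_⟩
  · simp_rw [truncGibbs_eq]
    exact key _ fun N i => boltzmann_pos _ _ _
  · exact key _ fun N i => zetaTerm_pos _ _ _
  · refine le_liminf_of_eventually_sub_le (b := 2) ?_ fun ε hε => ?_
    · filter_upwards [hk'.eventually_ge_atTop 1] with N hN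
      exact tvDist_truncated_le_two _ (fun i => zetaTerm_pos _ _ _) (fun i => zetaTerm_pos _ _ _)
        hk hN
    · filter_upwards [hk'.eventually_gt_atTop k, hpow] with N hN hkN
      have h3 := le_tvDist_truncated (energy fun α => J N α ω) (zetaTerm_pos β w)
        (zetaTerm_le_one hβ0 hw0) (u := fun i => zetaTerm β w i) (fun i => zetaTerm_pos _ _ _)
        hk hN hkN
      rw [tvDist_comm, truncExp_eq, truncExp_eq]
      refine le_trans ?_ h3
      have h4 := sum_Ico_zetaTerm_le_zetaPartial (β := β) w (Nat.lt_succ_self k)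
      have h5 : 0 ≤ ∑ i ∈ Finset.Ico 2 (k + 1), zetaTerm β w i :=
        Finset.sum_nonneg fun j _ => (zetaTerm_pos _ _ _).le
      have h6 := div_le_div_of_nonneg_left (zetaTerm_pos β w k).le
        (show 0 < 1 + ∑ i ∈ Finset.Ico 2 (k + 1), zetaTerm β w i by linarith)
        (show 1 + ∑ i ∈ Finset.Ico 2 (k + 1), zetaTerm β w i ≤ 1 + zeta β w by
          linarith [zetaPartial_le_zeta hs2 k.succ])
      linarith

end

/-! ### Building a uniform sample by inserting its maximum. -/

/-- The uniform distribution on the unit interval. -/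
noncomputable def unifMeasure : Measure ℝ := volume.restrict (Set.Icc 0 1)

instance : IsProbabilityMeasure unifMeasure := ⟨by simp [unifMeasure]⟩

theorem unifMeasure_eq_restrict_Ioo : unifMeasure = volume.restrict (Set.Ioo 0 1) :=
  (Measure.restrict_congr_set Ioo_ae_eq_Icc).symm

/-- The uniform distribution on `n + 1` points. -/
noncomputable def finUnif (n : ℕ) : Measure (Fin (n + 1)) :=
  ((n + 1 : ℕ) : ENNReal)⁻¹ • Measure.count

instance (n : ℕ) : IsProbabilityMeasure (finUnif n) := ⟨by
  rw [finUnif, Measure.smul_apply, Measure.count_univ, ENat.card_eq_coe_fintype_card,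
    Fintype.card_fin, smul_eq_mul]
  exact ENNReal.inv_mul_cancel (by simp) (by simp)⟩

instance : IsProbabilityMeasure (expMeasure 1) := isProbabilityMeasure_expMeasure one_pos

theorem map_stdCdf : (gaussianReal 0 1).map stdCdf = unifMeasure := by
  have hm : Measurable stdCdf := continuous_stdCdf.measurable
  ext A hA
  rw [Measure.map_apply hm hA, gaussianReal_of_var_ne_zero 0 one_ne_zero,
    withDensity_apply _ (hm hA), unifMeasure_eq_restrict_Ioo, ← range_stdCdf, ← Set.image_univ,
    ← lintegral_indicator_one hA, lintegral_image_eq_lintegral_abs_deriv_mul MeasurableSet.univ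
      (fun x _ => (hasDerivAt_stdCdf x).hasDerivWithinAt) strictMono_stdCdf.injective.injOn,
    Measure.restrict_univ, ← lintegral_indicator (hm hA)]
  refine lintegral_congr fun x => ?_
  rw [abs_of_pos (stdPdf_pos x)]
  by_cases hx : stdCdf x ∈ A
  · rw [Set.indicator_of_mem (show x ∈ stdCdf ⁻¹' A from hx), Set.indicator_of_mem hx]
    simp [gaussianPDF]
  · rw [Set.indicator_of_notMem (show x ∉ stdCdf ⁻¹' A from hx), Set.indicator_of_notMem hx]
    simp

/-- A measurable quantile function of the standard Gaussian distribution. -/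
theorem exists_quantile : ∃ Q : ℝ → ℝ, Measurable Q ∧ (∀ x, Q (stdCdf x) = x) ∧
    unifMeasure.map Q = gaussianReal 0 1 := by
  obtain ⟨Q, hQ, h⟩ := (continuous_stdCdf.measurableEmbedding
    strictMono_stdCdf.injective).exists_measurable_extend measurable_id fun _ => ⟨0⟩
  refine ⟨Q, hQ, congrFun h, ?_⟩
  rw [← map_stdCdf, Measure.map_map hQ continuous_stdCdf.measurable, h, Measure.map_id]

/-- Substitution t = e^{-w/(n+1)}: this variable has density (n+1) tⁿ, that of the maximum of n + 1
uniforms. -/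
theorem lintegral_expMeasure_comp_exp (n : ℕ) {g : ℝ → ENNReal} (hg : Measurable g) :
    ∫⁻ w, g (Real.exp (-(w / ((n : ℝ) + 1)))) ∂expMeasure 1 =
      ∫⁻ t in Set.Ioo 0 1, ENNReal.ofReal (((n : ℝ) + 1) * t ^ n) * g t := by
  set f : ℝ → ℝ := fun w => Real.exp (-(w / ((n : ℝ) + 1))) with hf
  have hn : (0 : ℝ) < (n : ℝ) + 1 := by positivity
  have hd : ∀ w, HasDerivAt f (-(f w / ((n : ℝ) + 1))) w := fun w => by
    have h := ((hasDerivAt_id w).div_const ((n : ℝ) + 1)).neg.exp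
    exact h.congr_deriv (by simp [hf]; ring)
  have himage : f '' Set.Ioi 0 = Set.Ioo 0 1 := by
    ext t
    constructor
    · rintro ⟨w, hw, rfl⟩
      exact ⟨Real.exp_pos _, Real.exp_lt_one_iff.2 (neg_neg_of_pos (div_pos hw hn))⟩
    · intro ht
      refine ⟨-(((n : ℝ) + 1) * Real.log t), ?_, ?_⟩
      · have := Real.log_neg ht.1 ht.2
        exact neg_pos.2 (mul_neg_of_pos_of_neg hn this)
      · simp only [hf]
        rw [neg_div, neg_neg, mul_div_cancel_left₀ _ hn.ne', Real.exp_log ht.1]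
  have hinj : Set.InjOn f (Set.Ioi 0) := fun x _ y _ hxy => by
    have := Real.exp_injective hxy
    rwa [neg_inj, div_left_inj' hn.ne'] at this
  have hm : Measurable (exponentialPDF 1) := (measurable_exponentialPDFReal 1).ennreal_ofReal
  have hexp : expMeasure 1 = volume.withDensity (exponentialPDF 1) := rfl
  have hgf : Measurable fun w : ℝ => g (Real.exp (-(w / ((n : ℝ) + 1)))) :=
    hg.comp (by fun_prop)
  rw [← himage, lintegral_image_eq_lintegral_abs_deriv_mul measurableSet_Ioi
    (fun w _ => (hd w).hasDerivWithinAt) hinj, hexp,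
    lintegral_withDensity_eq_lintegral_mul _ hm hgf,
    setLIntegral_congr Ioi_ae_eq_Ici, ← lintegral_indicator measurableSet_Ici]
  refine lintegral_congr fun w => ?_
  rw [Pi.mul_apply, exponentialPDF_eq, Set.indicator_apply]
  simp only [Set.mem_Ici, one_mul]
  split_ifs with hw
  · rw [← mul_assoc, ← ENNReal.ofReal_mul (abs_nonneg _)]
    congr 2
    have hfp : 0 < f w := Real.exp_pos _
    rw [abs_neg, abs_of_pos (by positivity)]
    have e : f w * f w ^ n = Real.exp (-w) := by
      rw [← pow_succ', hf]
      simp only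
      rw [← Real.exp_nat_mul]
      congr 1
      push_cast
      field_simp
    rw [← e]
    field_simp
  · simp

/-- Insert the new maximum `M = exp (-w / (n + 1))` at position `i` and shrink the other points
by the factor `M`. -/
noncomputable def insertMax (n : ℕ) (p : (ℝ × Fin (n + 1)) × (Fin n → ℝ)) : Fin (n + 1) → ℝ :=
  (p.1.2).insertNth (α := fun _ => ℝ) (Real.exp (-(p.1.1 / ((n : ℝ) + 1))))
    (Real.exp (-(p.1.1 / ((n : ℝ) + 1))) • p.2)

theorem measurable_insertNth {n : ℕ} (i : Fin (n + 1)) :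
    Measurable fun q : ℝ × (Fin n → ℝ) => i.insertNth (α := fun _ => ℝ) q.1 q.2 :=
  (MeasurableEquiv.piFinSuccAbove (fun _ : Fin (n + 1) => ℝ) i).symm.measurable

theorem measurable_insertMax (n : ℕ) : Measurable (insertMax n) := by
  have h : ∀ i : Fin (n + 1), Measurable fun q : ℝ × (Fin n → ℝ) => insertMax n ((q.1, i), q.2) :=
    fun i => (measurable_insertNth i).comp (f := fun q : ℝ × (Fin n → ℝ) =>
      (Real.exp (-(q.1 / ((n : ℝ) + 1))), Real.exp (-(q.1 / ((n : ℝ) + 1))) • q.2)) (by fun_prop)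
  have h2 : Measurable fun r : (ℝ × (Fin n → ℝ)) × Fin (n + 1) =>
      insertMax n ((r.1.1, r.2), r.1.2) := measurable_from_prod_countable_left h
  exact h2.comp (f := fun p : (ℝ × Fin (n + 1)) × (Fin n → ℝ) => ((p.1.1, p.2), p.1.2))
    (by fun_prop)

-- Up to the constraint of the cube, the left set lies in the t-dilate of the right one, and
-- dilation scales Lebesgue measure by tⁿ.
open scoped Pointwise in
theorem pi_unifMeasure_le {n : ℕ} {t : ℝ} (ht : 0 < t) (B : Set (Fin n → ℝ)) :
    Measure.pi (fun _ : Fin n => unifMeasure) {y | y ∈ B ∧ ∀ j, y j ≤ t} ≤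
      ENNReal.ofReal (t ^ n) * Measure.pi (fun _ : Fin n => unifMeasure) {y | t • y ∈ B} := by
  have hC : MeasurableSet (Set.univ.pi fun _ : Fin n => Set.Icc (0 : ℝ) 1) :=
    MeasurableSet.univ_pi fun _ => measurableSet_Icc
  have hL : Measure.pi (fun _ : Fin n => unifMeasure) =
      (volume : Measure (Fin n → ℝ)).restrict (Set.univ.pi fun _ => Set.Icc 0 1) :=
    (Measure.restrict_pi_pi _ _).symm
  rw [hL, Measure.restrict_apply' hC, Measure.restrict_apply' hC]
  calc _ ≤ volume (t • ({y | t • y ∈ B} ∩ Set.univ.pi fun _ : Fin n => Set.Icc (0 : ℝ) 1)) := by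
        refine measure_mono fun y hy => ?_
        rw [Set.mem_smul_set_iff_inv_smul_mem₀ ht.ne']
        refine ⟨?_, fun j _ => ⟨?_, ?_⟩⟩
        · change t • t⁻¹ • y ∈ B
          rw [smul_inv_smul₀ ht.ne']
          exact hy.1.1
        · exact mul_nonneg (inv_nonneg.2 ht.le) (hy.2 j trivial).1
        · change t⁻¹ * y j ≤ 1
          rw [inv_mul_le_one₀ ht]
          exact hy.1.2 j
    _ = _ := by
        rw [Measure.addHaar_smul, Module.finrank_fin_fun, abs_of_pos (by positivity)]

/-- A uniform sample of size `n + 1` is obtained from one of size `n` by inserting an independent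
maximum at a uniformly distributed position. -/
theorem map_insertMax (n : ℕ) :
    (((expMeasure 1).prod (finUnif n)).prod (Measure.pi fun _ : Fin n => unifMeasure)).map
      (insertMax n) = Measure.pi fun _ : Fin (n + 1) => unifMeasure := by
  have : IsProbabilityMeasure ((((expMeasure 1).prod (finUnif n)).prod
      (Measure.pi fun _ : Fin n => unifMeasure)).map (insertMax n)) :=
    Measure.isProbabilityMeasure_map (measurable_insertMax n).aemeasurable
  -- Between probability measures an inequality is already equality. Covering by the events that x_i
  -- is maximal may then overcount ties harmlessly.
  refine (Measure.eq_of_le_of_isProbabilityMeasure (Measure.le_iff.2 fun A hA => ?_)).symm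
  let Λ := Measure.pi fun _ : Fin n => unifMeasure
  let G : Fin (n + 1) → ℝ → ENNReal := fun i t =>
    Λ {y | i.insertNth (α := fun _ => ℝ) t (t • y) ∈ A}
  have hG : ∀ i, Measurable (G i) := fun i =>
    measurable_measure_prodMk_left (ν := Λ) (s := {q : ℝ × (Fin n → ℝ) |
      i.insertNth (α := fun _ => ℝ) q.1 (q.1 • q.2) ∈ A})
      (((measurable_insertNth i).comp (f := fun q : ℝ × (Fin n → ℝ) => (q.1, q.1 • q.2))
        (by fun_prop)) hA)
  have hGM : ∀ i, Measurable fun w : ℝ => G i (Real.exp (-(w / ((n : ℝ) + 1)))) := fun i =>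
    (hG i).comp (by fun_prop)
  have hR : (((expMeasure 1).prod (finUnif n)).prod Λ).map (insertMax n) A =
      ∑ i, ∫⁻ t in Set.Ioo 0 1, ENNReal.ofReal (t ^ n) * G i t := by
    rw [Measure.map_apply (measurable_insertMax n) hA,
      Measure.prod_apply (measurable_insertMax n hA),
      lintegral_prod _ (measurable_measure_prodMk_left (measurable_insertMax n hA)).aemeasurable]
    have h1 : ∀ w : ℝ, ∫⁻ i, Λ (Prod.mk (w, i) ⁻¹' (insertMax n ⁻¹' A)) ∂finUnif n =
        ∑ i, ((n + 1 : ℕ) : ENNReal)⁻¹ * G i (Real.exp (-(w / ((n : ℝ) + 1)))) := fun w => by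
      rw [finUnif, lintegral_smul_measure, lintegral_count, tsum_fintype, smul_eq_mul,
        Finset.mul_sum]
      rfl
    simp_rw [h1]
    rw [lintegral_finsetSum _ fun i _ => (hGM i).const_mul _]
    refine Finset.sum_congr rfl fun i _ => ?_
    rw [lintegral_const_mul _ (hGM i), lintegral_expMeasure_comp_exp n (hG i),
      ← lintegral_const_mul _ (by have := hG i; fun_prop)]
    refine lintegral_congr fun t => ?_
    rw [ENNReal.ofReal_mul (by positivity), ← mul_assoc, ← mul_assoc]
    have h2 : ENNReal.ofReal ((n : ℝ) + 1) = ((n + 1 : ℕ) : ENNReal) := by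
      rw [← ENNReal.ofReal_natCast]; push_cast; rfl
    rw [h2, ENNReal.inv_mul_cancel (by simp) (by simp), one_mul]
  rw [hR]
  have hmax : ∀ i : Fin (n + 1), MeasurableSet {x : Fin (n + 1) → ℝ | ∀ j, x j ≤ x i} := fun i => by
    rw [Set.ofPred_forall]
    exact MeasurableSet.iInter fun j => measurableSet_le (measurable_pi_apply j)
      (measurable_pi_apply i)
  calc Measure.pi (fun _ : Fin (n + 1) => unifMeasure) A
      ≤ Measure.pi (fun _ : Fin (n + 1) => unifMeasure)
          (⋃ i, A ∩ {x : Fin (n + 1) → ℝ | ∀ j, x j ≤ x i}) := by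
        refine measure_mono fun x hx => Set.mem_iUnion.2 ?_
        obtain ⟨i, hi⟩ := Finite.exists_max x
        exact ⟨i, hx, hi⟩
    _ ≤ ∑ i, Measure.pi (fun _ : Fin (n + 1) => unifMeasure)
          (A ∩ {x : Fin (n + 1) → ℝ | ∀ j, x j ≤ x i}) := measure_iUnion_fintype_le _ _
    _ ≤ _ := Finset.sum_le_sum fun i _ => by
        have hmp := (measurePreserving_piFinSuccAbove
          (fun _ : Fin (n + 1) => unifMeasure) i).symm
        have hS := hA.inter (hmax i)
        rw [← hmp.measure_preimage hS.nullMeasurableSet, Measure.prod_apply (hmp.measurable hS),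
          unifMeasure_eq_restrict_Ioo]
        refine setLIntegral_mono' measurableSet_Ioo fun t ht => ?_
        rw [← unifMeasure_eq_restrict_Ioo]
        refine (measure_mono fun y hy => ?_).trans
          (pi_unifMeasure_le ht.1 {y | i.insertNth (α := fun _ => ℝ) t y ∈ A})
        have h2 : i.insertNth (α := fun _ => ℝ) t y ∈ A ∧ ∀ j,
          i.insertNth (α := fun _ => ℝ) t y j ≤ i.insertNth (α := fun _ => ℝ) t y i := hy
        refine ⟨h2.1, fun j => ?_⟩
        have := h2.2 (i.succAbove j)
        rwa [Fin.insertNth_apply_succAbove, Fin.insertNth_apply_same] at this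

/-! ### The coupling of all sample sizes. -/

/-- The sample space of the coupling: an exponential variable and an insertion position for
every sample size. -/
abbrev CouplingSpace : Type := (n : ℕ) → ℝ × Fin (n + 1)

/-- The product measure on `CouplingSpace`. -/
noncomputable def couplingMeasure : Measure CouplingSpace :=
  Measure.infinitePi fun n => (expMeasure 1).prod (finUnif n)

instance : IsProbabilityMeasure couplingMeasure := by
  unfold couplingMeasure; infer_instance

/-- The uniform samples of all sizes, built by inserting successive maxima. -/
noncomputable def points : (n : ℕ) → CouplingSpace → Fin n → ℝ
  | 0, _ => Fin.elim0
  | n + 1, z => insertMax n (z n, points n z)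

/-- The sample of size n uses only coordinates below n, hence is independent of the n-th insertion.
-/
theorem exists_points_eq_comp_restrict (n : ℕ) :
    ∃ g : ((i : Finset.range n) → ℝ × Fin ((i : ℕ) + 1)) → Fin n → ℝ, Measurable g ∧
      ∀ z, points n z = g fun i => z i := by
  induction n with
  | zero => exact ⟨fun _ => Fin.elim0, measurable_const, fun z => rfl⟩
  | succ n ih =>
    obtain ⟨g, hg, h⟩ := ih
    refine ⟨fun v => insertMax n (v ⟨n, by simp⟩, g fun i => v ⟨i, by
      have := Finset.mem_range.1 i.2; simp; omega⟩), ?_, fun z => ?_⟩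
    · refine (measurable_insertMax n).comp ((measurable_pi_apply _).prodMk (hg.comp ?_))
      exact measurable_pi_iff.2 fun i => measurable_pi_apply _
    · rw [points, h]

theorem hasLaw_points (n : ℕ) :
    HasLaw (points n) (Measure.pi fun _ : Fin n => unifMeasure) couplingMeasure := by
  have hcoord : iIndepFun (fun (n : ℕ) (z : CouplingSpace) => z n) couplingMeasure :=
    iIndepFun_infinitePi (X := fun _ x => x) fun _ => measurable_id
  induction n with
  | zero =>
    have hm : Measurable (points 0) := measurable_const
    refine ⟨hm.aemeasurable, ?_⟩
    have : IsProbabilityMeasure (couplingMeasure.map (points 0)) :=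
      Measure.isProbabilityMeasure_map hm.aemeasurable
    refine Measure.eq_of_le_of_isProbabilityMeasure (Measure.le_iff.2 fun s _ => ?_)
    rcases s.eq_empty_or_nonempty with rfl | hs
    · simp
    · rw [Subsingleton.eq_univ_of_nonempty hs, measure_univ, measure_univ]
  | succ n ih =>
    obtain ⟨g, hg, h⟩ := exists_points_eq_comp_restrict n
    have hz : HasLaw (fun z : CouplingSpace => z n) ((expMeasure 1).prod (finUnif n))
        couplingMeasure := (measurePreserving_eval_infinitePi
      (fun n => (expMeasure 1).prod (finUnif n)) n).hasLaw
    have hind : IndepFun (fun z : CouplingSpace => z n) (points n) couplingMeasure := by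
      have h1 := hcoord.indepFun_finset {n} (Finset.range n) (by simp)
        (fun i => measurable_pi_apply i)
      have h2 := h1.comp (measurable_pi_apply (⟨n, by simp⟩ : ({n} : Finset ℕ))) hg
      exact h2.congr (Eventually.of_forall fun z => rfl) (Eventually.of_forall fun z => (h z).symm)
    have hpair := (indepFun_iff_hasLaw_prodMk_prod hz ih).1 hind
    have := HasLaw.comp (Y := insertMax n)
      ⟨(measurable_insertMax n).aemeasurable, map_insertMax n⟩ hpair
    exact this

/-- The values of the order statistics of the sample of size `n`. -/
noncomputable def orderValue (n : ℕ) (z : CouplingSpace) (j : ℕ) : ℝ :=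
  Real.exp (-∑ l ∈ Finset.Ico j n, (z l).1 / ((l : ℝ) + 1))

/-- Each insertion adds the largest value and multiplies the others by one factor, so the
permutation sends the last index to the insertion position and extends the previous one elsewhere.
-/
theorem exists_points_perm (n : ℕ) (z : CouplingSpace) :
    ∃ e : Equiv.Perm (Fin n), ∀ j, points n z (e j) = orderValue n z j := by
  induction n with
  | zero => exact ⟨Equiv.refl _, fun j => j.elim0⟩
  | succ n ih =>
    obtain ⟨e, he⟩ := ih
    refine ⟨(finSuccEquivLast.trans (Equiv.optionCongr e)).trans (finSuccEquiv' (z n).2).symm,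
      fun j => ?_⟩
    induction j using Fin.lastCases with
    | last => simp [points, insertMax, orderValue]
    | cast j =>
      have h1 : orderValue (n + 1) z j =
          Real.exp (-((z n).1 / ((n : ℝ) + 1))) * orderValue n z j := by
        rw [orderValue, orderValue, ← Real.exp_add, Finset.sum_Ico_succ_top j.2.le]
        ring_nf
      simp [points, insertMax, he, h1]

theorem orderValue_mono {z : CouplingSpace} (hz : ∀ l, 0 < (z l).1) (n : ℕ) :
    Monotone (orderValue n z) := fun i j hij => by
  refine Real.exp_le_exp.2 (neg_le_neg ?_)
  exact Finset.sum_le_sum_of_subset_of_nonneg (Finset.Ico_subset_Ico_left hij)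
    fun l _ _ => div_nonneg (hz l).le (by positivity)

theorem orderValue_mem_Ioo {z : CouplingSpace} (hz : ∀ l, 0 < (z l).1) {n j : ℕ} (hj : j < n) :
    orderValue n z j ∈ Set.Ioo 0 1 := by
  refine ⟨Real.exp_pos _, Real.exp_lt_one_iff.2 (neg_neg_of_pos ?_)⟩
  exact Finset.sum_pos (fun l _ => div_pos (hz l) (by positivity)) (by simpa using hj)

/-- The couplings whose energies are the given numbers. -/
noncomputable def couplings {N : ℕ} (x : SpinConfig N → ℝ) (α : Finset (Fin N)) : ℝ :=
  ∑ σ, (charMatrix N).transpose α σ * x σ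

theorem energy_couplings {N : ℕ} (x : SpinConfig N → ℝ) : energy (couplings x) = x := by
  funext σ
  have h1 : couplings x = (charMatrix N).transpose.mulVec x := rfl
  have h2 : energy (couplings x) σ = (charMatrix N).mulVec (couplings x) σ :=
    energy_eq_sum_charMatrix _ _
  rw [h2, h1, Matrix.mulVec_mulVec, charMatrix_mul_transpose, Matrix.one_mulVec]

/-- The energies of the coupled samples, for the quantile function `Q`. -/
noncomputable def coupledEnergy (Q : ℝ → ℝ) (N : ℕ) (z : CouplingSpace) (σ : SpinConfig N) : ℝ :=
  Q (points (2 ^ N) z ((enumeration N).symm σ))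

theorem orderedUnif_couplings {Q : ℝ → ℝ} (hQ : ∀ x, Q (stdCdf x) = x) {z : CouplingSpace}
    (hz : ∀ l, 0 < (z l).1) (N : ℕ) {i : ℕ} (hi : i ≤ 2 ^ N) :
    orderedUnif (couplings (coupledEnergy Q N z)) (i + 1) = orderValue (2 ^ N) z i := by
  -- At i = 2^N the convention U_{n+1} = 1 matches the empty sum in `orderValue`.
  rcases hi.eq_or_lt with rfl | hi
  · simp [orderedUnif, orderValue]
  obtain ⟨e, he⟩ := exists_points_perm (2 ^ N) z
  have hQ' : ∀ u ∈ Set.Ioo (0 : ℝ) 1, stdCdf (Q u) = u := fun u hu => by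
    rw [← range_stdCdf] at hu
    obtain ⟨x, rfl⟩ := hu
    rw [hQ]
  have hpt : ∀ k, stdCdf (coupledEnergy Q N z (enumeration N k)) = points (2 ^ N) z k := fun k => by
    rw [coupledEnergy, Equiv.symm_apply_apply]
    obtain ⟨j, rfl⟩ := e.surjective k
    exact hQ' _ (by rw [he]; exact orderValue_mem_Ioo hz j.2)
  have h1 : Monotone (points (2 ^ N) z ∘ e) := fun i j hij => by
    simp only [Function.comp_apply, he]
    exact orderValue_mono hz _ hij
  have h2 : Monotone (points (2 ^ N) z ∘ Tuple.sort (coupledEnergy Q N z ∘ enumeration N)) :=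
    fun i j hij => by
      simp only [Function.comp_apply, ← hpt]
      exact monotone_cdf _ (Tuple.monotone_sort (coupledEnergy Q N z ∘ enumeration N) hij)
  -- Two monotone rearrangements of one tuple coincide, so tie-breaking is irrelevant.
  have h3 := congrFun (Tuple.unique_monotone h2 h1) ⟨i, hi⟩
  simp only [Function.comp_apply, he, ← hpt] at h3
  rw [orderedUnif_succ _ hi, ← Fin.val_mk hi, sortedEnergy_val _ ⟨i, hi⟩, energy_couplings]
  exact h3

/-- Consecutive order values differ in a single summand, which does not involve the sample size;
this makes the link hold for all N at once. -/
theorem spacing_couplings {Q : ℝ → ℝ} (hQ : ∀ x, Q (stdCdf x) = x) {z : CouplingSpace}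
    (hz : ∀ l, 0 < (z l).1) {N l : ℕ} (hl : l < 2 ^ N) :
    spacing (couplings (coupledEnergy Q N z)) (l + 1) = (z l).1 := by
  rw [spacing, orderedUnif_couplings hQ hz N hl.le, orderedUnif_couplings hQ hz N hl,
    orderValue, orderValue, ← Real.exp_sub, Real.log_pow, Real.log_exp,
    Finset.sum_eq_sum_Ico_succ_bot hl]
  push_cast
  have : (l : ℝ) + 1 ≠ 0 := by positivity
  field_simp
  ring

theorem isDisorder_couplings {Q : ℝ → ℝ} (hQm : Measurable Q)
    (hQ : unifMeasure.map Q = gaussianReal 0 1) :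
    IsDisorder couplingMeasure fun N α z => couplings (coupledEnergy Q N z) α := by
  have key : ∀ N, (∀ σ : SpinConfig N,
      HasLaw (fun z => coupledEnergy Q N z σ) (gaussianReal 0 1) couplingMeasure) ∧
      iIndepFun (fun (σ : SpinConfig N) z => coupledEnergy Q N z σ) couplingMeasure := by
    intro N
    have hp := hasLaw_points (2 ^ N)
    have h1 : ∀ i, HasLaw (fun z => points (2 ^ N) z i) unifMeasure couplingMeasure := fun i =>
      HasLaw.fun_comp (measurePreserving_eval (fun _ : Fin (2 ^ N) => unifMeasure) i).hasLaw hp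
    have h2 : iIndepFun (fun i z => points (2 ^ N) z i) couplingMeasure :=
      (iIndepFun_iff_hasLaw_pi_pi h1).2 hp
    exact ⟨fun σ => HasLaw.fun_comp ⟨hQm.aemeasurable, hQ⟩ (h1 _),
      (h2.comp (fun _ => Q) fun _ => hQm).precomp (enumeration N).symm.injective⟩
  have hA : ∀ N, (charMatrix N).transpose * (charMatrix N).transpose.transpose = 1 := fun N => by
    rw [Matrix.transpose_transpose, charMatrix_transpose_mul]
  exact ⟨fun N => (iid_gaussian_of_mul_transpose_eq_one (key N).1 (key N).2 _ (hA N)).1,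
    fun N => (iid_gaussian_of_mul_transpose_eq_one (key N).1 (key N).2 _ (hA N)).2⟩

theorem exists_isCoupling : ∃ (Ω' : Type) (_ : MeasurableSpace Ω') (P' : Measure Ω')
    (J' : (N : ℕ) → Finset (Fin N) → Ω' → ℝ) (W' : ℕ → Ω' → ℝ),
    IsProbabilityMeasure P' ∧ IsCoupling P' J' W' := by
  obtain ⟨Q, hQm, hQ, hmap⟩ := exists_quantile
  have hlaw : ∀ l, HasLaw (fun z : CouplingSpace => (z l).1) (expMeasure 1) couplingMeasure :=
    fun l => HasLaw.fun_comp (measurePreserving_fst (μ := expMeasure 1) (ν := finUnif l)).hasLaw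
      (measurePreserving_eval_infinitePi (fun n => (expMeasure 1).prod (finUnif n)) l).hasLaw
  refine ⟨CouplingSpace, inferInstance, couplingMeasure,
    -- Coordinate l - 1 carries W_l; the value at l = 0 is immaterial.
    fun N α z => couplings (coupledEnergy Q N z) α, fun l z => (z (l - 1)).1, inferInstance,
    isDisorder_couplings hQm hmap, fun l _ => hlaw (l - 1), ?_, ?_⟩
  · exact iIndepFun_infinitePi (P := fun n => (expMeasure 1).prod (finUnif n))
      (X := fun n (x : ℝ × Fin (n + 1)) => x.1) fun _ => measurable_fst
  · filter_upwards [ae_all_iff.2 fun l => ae_pos_of_hasLaw_expMeasure (hlaw l)] with z hz N l h1 h2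
    obtain ⟨l, rfl⟩ := Nat.exists_eq_add_of_le' h1
    exact spacing_couplings hQ hz h2

end REM

theorem mainTheorem11 {Ω : Type*} [MeasurableSpace Ω] (P : Measure Ω) [IsProbabilityMeasure P]
    (J : (N : ℕ) → Finset (Fin N) → Ω → ℝ) (hJ : REM.IsDisorder P J)
    (β : ℝ) (hβ : REM.betaC < β) :
    -- any joint law of the samples of different sizes
    (∀ᵐ ω ∂P, ∀ k₀ : ℕ, 1 ≤ k₀ →
      (∀ ε : ℝ, 0 < ε → ∀ᶠ N : ℕ in atTop,
        Real.exp (-(β / REM.betaC) * REM.weightedSum (REM.spacing (fun α => J N α ω)) k₀) /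
            (1 + REM.zetaPartial β (REM.spacing (fun α => J N α ω)) (2 ^ N)) - ε ≤
          REM.tvDist (REM.gibbs β (fun α => J N α ω))
            (REM.truncGibbs β (fun α => J N α ω) k₀)) ∧
      ¬ Tendsto (fun N : ℕ => REM.tvDist (REM.gibbs β (fun α => J N α ω))
            (REM.truncGibbs β (fun α => J N α ω) k₀)) atTop (𝓝 0)) ∧
    -- all samples realised from one sequence of exponential variables
    (∀ W : ℕ → Ω → ℝ, REM.IsCoupling P J W →
      ∀ᵐ ω ∂P, Summable (fun j : ℕ => REM.zetaTerm β (fun l => W l ω) (j + 2)) ∧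
        ∀ k₀ : ℕ, 1 ≤ k₀ →
          0 < Real.exp (-(β / REM.betaC) * REM.weightedSum (fun l => W l ω) k₀) /
              (1 + REM.zeta β (fun l => W l ω)) ∧
          Real.exp (-(β / REM.betaC) * REM.weightedSum (fun l => W l ω) k₀) /
              (1 + REM.zeta β (fun l => W l ω)) ≤
            liminf (fun N : ℕ => REM.tvDist (REM.gibbs β (fun α => J N α ω))
              (REM.truncGibbs β (fun α => J N α ω) k₀)) atTop ∧
          Real.exp (-(β / REM.betaC) * REM.weightedSum (fun l => W l ω) k₀) /
              (1 + REM.zeta β (fun l => W l ω)) ≤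
            liminf (fun N : ℕ => REM.tvDist (REM.gibbs β (fun α => J N α ω))
              (REM.truncExp β (fun α => J N α ω) (fun l => W l ω) k₀)) atTop ∧
          ∀ k : ℕ → ℕ, Tendsto k atTop atTop →
            Real.exp (-(β / REM.betaC) * REM.weightedSum (fun l => W l ω) k₀) /
                (1 + REM.zeta β (fun l => W l ω)) ≤
              liminf (fun N : ℕ => REM.tvDist
                (REM.truncExp β (fun α => J N α ω) (fun l => W l ω) k₀)
                (REM.truncExp β (fun α => J N α ω) (fun l => W l ω) (k N))) atTop) ∧
    -- such a realisation exists
    (∃ (Ω' : Type) (_ : MeasurableSpace Ω') (P' : Measure Ω')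
      (J' : (N : ℕ) → Finset (Fin N) → Ω' → ℝ) (W' : ℕ → Ω' → ℝ),
      IsProbabilityMeasure P' ∧ REM.IsCoupling P' J' W') := by
  have hβ0 : 0 ≤ β := REM.betaC_pos.le.trans hβ.le
  exact ⟨hJ.ae_arbitrary_law hβ0, fun W hW => hW.ae_liminf hβ, REM.exists_isCoupling⟩
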